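/- Let $G=(V,E)$ be a finite simple graph and let $D=(E,A)$ be a digraph whose vertices are the edges of $G$. For $e\in E$ put $\mathrm{dep}(e)=\{e'\in E : (e',e)\in A\}$. Given $\ell,u:E\to\mathbb N$ and $w:E\to\mathbb R$, the problem G-DCMST$(G,D,\ell,u,w)$ asks for a spanning tree $T$ of $G$ with $\ell(e)\le |\mathrm{dep}(e)\cap E(T)|\le u(e)$ for every $e\in E(T)$ that minimizes $\sum_{e\in E(T)}w(e)$ among all such trees, or for the answer that no such tree exists. Theorem. There is an algorithm that solves G-DCMST$(G,D,0,u,w)$ in polynomial time on all instances $(G,D,0,u,w)$ in which $D=D_1\cup\dots\cup D_k$ is the union of $k$ disjoint (loopless) complete digraphs with $V(D_1)\cup\dots\cup V(D_k)=E$ and, for each $i\in\{1,\dots,k\}$, there exists $u_i\in\{1,\dots,|V(D_i)|\}$ such that $u(e)=u_i-1$ for every $e\in V(D_i)$. Here the algorithm is a single program for a random access machine whose cells hold natural or real numbers, with additions, subtractions, comparisons and memory accesses as its unit-cost operations and without real constants. The graph $G$ is given by the list of its edges, $D$ by the list of its arcs, and $\ell,u,w$ by the lists of their values, and the running time is at most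 $p(|V|+|E|+|A|)$ for a fixed polynomial $p$. The partition into $D_1,\dots,D_k$ and the numbers $u_i$ are not part of the input. -/

import Mathlib

/-! ### The problem -/

namespace GDC

/-- An instance `(G, D, ℓ, u, w)`: a simple graph `G`, a digraph `D` whose vertices are the edges of
`G`, lower and upper bounds `ℓ, u` and real weights `w` on the edges of `G`. -/
structure Inst (V : Type*) where
  G : SimpleGraph V
  D : Digraph G.edgeSet
  lo : G.edgeSet → ℕ
  up : G.edgeSet → ℕ
  w : G.edgeSet → ℝ

variable {V : Type*}

/-- The dependency set of `e`: all `e'` such that `(e', e)` is an arc of `D`. -/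
def Inst.dep (I : Inst V) (e : I.G.edgeSet) : Set I.G.edgeSet :=
  {e' | I.D.Adj e' e}

/-- The edges of `G` that belong to `H`, as a set of vertices of `D`. -/
def Inst.edgesOf (I : Inst V) (H : SimpleGraph V) : Set I.G.edgeSet :=
  {e | (e : Sym2 V) ∈ H.edgeSet}

/-- `H` `(ℓ, u)`-satisfies `D`. -/
def Inst.Satisfies (I : Inst V) (H : SimpleGraph V) : Prop :=
  ∀ e ∈ I.edgesOf H,
    I.lo e ≤ (I.dep e ∩ I.edgesOf H).ncard ∧ (I.dep e ∩ I.edgesOf H).ncard ≤ I.up e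

/-- `T` is a spanning tree of `G` that `(ℓ, u)`-satisfies `D`. -/
def Inst.IsFeasible (I : Inst V) (T : SimpleGraph V) : Prop :=
  T ≤ I.G ∧ T.IsTree ∧ I.Satisfies T

/-- The weight sum of the edges of `T`. -/
noncomputable def Inst.weight (I : Inst V) (T : SimpleGraph V) : ℝ :=
  ∑ᶠ e ∈ I.edgesOf T, I.w e

/-- `T` is an optimal solution: a feasible spanning tree of minimum weight sum. -/
def Inst.IsOptimal (I : Inst V) (T : SimpleGraph V) : Prop :=
  I.IsFeasible T ∧ ∀ T', I.IsFeasible T' → I.weight T ≤ I.weight T'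

/-- `D` is the union of the (loopless) complete digraphs with the pairwise disjoint vertex sets
`C 0, …, C (k - 1)`, which together exhaust the vertices of `D`. -/
structure IsDisjointUnionOfComplete {E : Type*} (D : Digraph E) {k : ℕ} (C : Fin k → Set E) :
    Prop where
  disjoint : ∀ i j, i ≠ j → Disjoint (C i) (C j)
  cover : ⋃ i, C i = Set.univ
  adj_iff : ∀ e f, D.Adj e f ↔ e ≠ f ∧ ∃ i, e ∈ C i ∧ f ∈ C i

end GDC

/-! ### The machine model

A random access machine with two kinds of cells, holding natural numbers and real numbers. Cells
are organised in arrays; the name of an array is a literal of the program, an index is computed.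
The only arithmetic is addition and subtraction, the only tests are comparisons, and there are no
real literals and no conversions between the two kinds. Every elementary operation costs one. -/

namespace RealRAM

/-- The memory: `nat a i` and `real a i` are the cells with index `i` of the arrays named `a`. -/
structure Mem where
  nat : ℕ → ℕ → ℕ
  real : ℕ → ℕ → ℝ

/-- Expressions with a natural number as value. -/
inductive NatExpr where
  | lit (c : ℕ)
  | get (a : ℕ) (i : NatExpr)
  | add (x y : NatExpr)
  | sub (x y : NatExpr)

/-- The value; subtraction is truncated at `0`. -/
def NatExpr.eval (s : Mem) : NatExpr → ℕ
  | lit c => c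
  | get a i => s.nat a (i.eval s)
  | add x y => x.eval s + y.eval s
  | sub x y => x.eval s - y.eval s

/-- The number of elementary operations in an evaluation. -/
def NatExpr.cost : NatExpr → ℕ
  | lit _ => 1
  | get _ i => i.cost + 1
  | add x y => x.cost + y.cost + 1
  | sub x y => x.cost + y.cost + 1

/-- Expressions with a real number as value. -/
inductive RealExpr where
  | get (a : ℕ) (i : NatExpr)
  | add (x y : RealExpr)
  | sub (x y : RealExpr)

noncomputable def RealExpr.eval (s : Mem) : RealExpr → ℝ
  | get a i => s.real a (i.eval s)
  | add x y => x.eval s + y.eval s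
  | sub x y => x.eval s - y.eval s

/-- The number of elementary operations in an evaluation. -/
def RealExpr.cost : RealExpr → ℕ
  | get _ i => i.cost + 1
  | add x y => x.cost + y.cost + 1
  | sub x y => x.cost + y.cost + 1

/-- Tests. -/
inductive Cond where
  | natLe (x y : NatExpr)
  | realLe (x y : RealExpr)
  | not (c : Cond)
  | and (c d : Cond)

def Cond.Holds (s : Mem) : Cond → Prop
  | natLe x y => x.eval s ≤ y.eval s
  | realLe x y => x.eval s ≤ y.eval s
  | not c => ¬ c.Holds s
  | and c d => c.Holds s ∧ d.Holds s

/-- The number of elementary operations in an evaluation. -/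
def Cond.cost : Cond → ℕ
  | natLe x y => x.cost + y.cost + 1
  | realLe x y => x.cost + y.cost + 1
  | not c => c.cost + 1
  | and c d => c.cost + d.cost + 1

/-- Programs. `setNat a i x` and `setReal a i x` write the value of `x` into the cell with index
`i` of the array `a`; `loop c p` runs `p` as long as `c` holds. -/
inductive Program where
  | skip
  | setNat (a : ℕ) (i x : NatExpr)
  | setReal (a : ℕ) (i : NatExpr) (x : RealExpr)
  | seq (p q : Program)
  | branch (c : Cond) (p q : Program)
  | loop (c : Cond) (p : Program)

def Mem.writeNat (s : Mem) (a i x : ℕ) : Mem :=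
  { s with nat := Function.update s.nat a (Function.update (s.nat a) i x) }

noncomputable def Mem.writeReal (s : Mem) (a i : ℕ) (x : ℝ) : Mem :=
  { s with real := Function.update s.real a (Function.update (s.real a) i x) }

/-- `Runs p s t s'`: started in memory `s`, the program `p` halts after exactly `t` steps, in
memory `s'`. -/
inductive Runs : Program → Mem → ℕ → Mem → Prop where
  | skip (s : Mem) : Runs .skip s 1 s
  | setNat (a : ℕ) (i x : NatExpr) (s : Mem) :
      Runs (.setNat a i x) s (i.cost + x.cost + 1) (s.writeNat a (i.eval s) (x.eval s))
  | setReal (a : ℕ) (i : NatExpr) (x : RealExpr) (s : Mem) :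
      Runs (.setReal a i x) s (i.cost + x.cost + 1) (s.writeReal a (i.eval s) (x.eval s))
  | seq {p q : Program} {s s₁ s₂ : Mem} {t₁ t₂ : ℕ} :
      Runs p s t₁ s₁ → Runs q s₁ t₂ s₂ → Runs (.seq p q) s (t₁ + t₂) s₂
  | branchTrue {c : Cond} {p q : Program} {s s₁ : Mem} {t : ℕ} :
      c.Holds s → Runs p s t s₁ → Runs (.branch c p q) s (c.cost + 1 + t) s₁
  | branchFalse {c : Cond} {p q : Program} {s s₁ : Mem} {t : ℕ} :
      ¬ c.Holds s → Runs q s t s₁ → Runs (.branch c p q) s (c.cost + 1 + t) s₁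
  | loopTrue {c : Cond} {p : Program} {s s₁ s₂ : Mem} {t₁ t₂ : ℕ} :
      c.Holds s → Runs p s t₁ s₁ → Runs (.loop c p) s₁ t₂ s₂ →
        Runs (.loop c p) s (c.cost + 1 + t₁ + t₂) s₂
  | loopFalse {c : Cond} {p : Program} {s : Mem} :
      ¬ c.Holds s → Runs (.loop c p) s (c.cost + 1) s

end RealRAM

/-! ### Instances as inputs of the machine -/

namespace GDC

open RealRAM

variable {V : Type*}

/-- A description of an instance: the vertices, the edges of `G` and the arcs of `D` are listed
without repetition, in an arbitrary order; an edge is given by its two ends, in either order, and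
an arc by its tail and its head. -/
structure Listing (I : Inst V) where
  n : ℕ
  m : ℕ
  a : ℕ
  vertex : Fin n ≃ V
  edge : Fin m ≃ I.G.edgeSet
  end₁ : Fin m → Fin n
  end₂ : Fin m → Fin n
  edge_eq : ∀ j, (edge j : Sym2 V) = s(vertex (end₁ j), vertex (end₂ j))
  tail : Fin a → Fin m
  head : Fin a → Fin m
  arc_iff : ∀ e f, I.D.Adj e f ↔ ∃ r, edge (tail r) = e ∧ edge (head r) = f
  arc_injective : ∀ r r', tail r = tail r' → head r = head r' → r = r'

/-- The size of the input: the number of vertices, edges and arcs. -/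
def Listing.size {I : Inst V} (L : Listing I) : ℕ :=
  L.n + L.m + L.a

/-- The finite list `f 0, …, f (k - 1)` as the content of an array, with zeros behind it. -/
def array {α : Type*} [Zero α] {k : ℕ} (f : Fin k → α) : ℕ → α :=
  fun i => if h : i < k then f ⟨i, h⟩ else 0

/-- The initial memory. The arrays of natural numbers hold `n, m, a` (array 0), the two ends of
each edge (1 and 2), the tail and the head of each arc (3 and 4), and the bounds `ℓ` and `u` of
each edge (5 and 6); the array 0 of real numbers holds the weights. All other cells are zero. -/
def Listing.input {I : Inst V} (L : Listing I) : Mem where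
  nat
    | 0 => array ![L.n, L.m, L.a]
    | 1 => array fun j => (L.end₁ j : ℕ)
    | 2 => array fun j => (L.end₂ j : ℕ)
    | 3 => array fun r => (L.tail r : ℕ)
    | 4 => array fun r => (L.head r : ℕ)
    | 5 => array fun j => I.lo (L.edge j)
    | 6 => array fun j => I.up (L.edge j)
    | _ => fun _ => 0
  real
    | 0 => array fun j => I.w (L.edge j)
    | _ => fun _ => 0

/-- The answer read from the final memory is correct: either cell 0 of array 7 is 1 and the edges
marked by 1 in array 8 are exactly the edges of an optimal solution, or cell 0 of array 7 is 0 and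
there is no feasible spanning tree. -/
def Listing.CorrectOutput {I : Inst V} (L : Listing I) (s : Mem) : Prop :=
  (s.nat 7 0 = 1 ∧ ∃ T, I.IsOptimal T ∧ ∀ j : Fin L.m, s.nat 8 j = 1 ↔ L.edge j ∈ I.edgesOf T) ∨
    (s.nat 7 0 = 0 ∧ ∀ T, ¬ I.IsFeasible T)

/-- On every description of the instance `I`, the program `P` halts with a correct output, after at
most `p(N)` steps, where `N` is the size of the input. -/
def SolvesWithin (P : Program) (p : Polynomial ℕ) (I : Inst V) : Prop :=
  ∀ L : Listing I, ∃ t s, Runs P L.input t s ∧ t ≤ p.eval L.size ∧ L.CorrectOutput s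

end GDC

/-! ### Connectivity by a list of edges -/

namespace GDC

/-! There are no loops in `D`, so `dep e` is the clique of `e` without `e` itself. For `ℓ = 0` the
condition therefore allows at most `u + 1` tree edges from each clique (`Represents.satisfies_iff`).
With the cliques as colours, the task is a weighted intersection of a graphic and a partition
matroid. It is solved by a primal-dual method with one penalty per colour.

A `Dual` pair consists of a spanning tree that is minimal for the weights plus penalties, and of
nonnegative penalties that vanish on colours with room left. If its tree respects the bounds, it is
optimal by complementary slackness (`Dual.weight_le`). The start is a minimum spanning tree with
zero penalties, and each round lowers the `excess` over the bounds. A `Search` collects the colours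
from which exchanges of change zero lead to a colour with room. To continue, the penalties of all
unreached colours are raised by the least amount that makes a further exchange tight
(`Search.extend`). If an overused colour is reached, the exchanges on its path are carried out
(`Walk.dual_and_excess_lt`). If none is, no exchange leaves the set of unreached colours, and 0-1
weights show that no tree uses fewer edges from this set (`Net.not_feasible`).

The delicate point is that exchanges which are possible one by one can also be made in succession.
The minimum trees for the modified weights inherit the symmetric exchange property
(`SymmExchange.minWeight`), and every reached colour points to a colour of least order among its
tight exchanges. The exchanges on a path thus form a triangular system, which `exchange_exchange`
and `not_exchange_exchange` preserve from step to step (`Walk.step`).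

On the machine all loops are bounded by the number of vertices, edges or arcs. A polynomial time
bound is then read off the syntax (`Block.exists_runs`), and correctness reduces to loop invariants
(`Block.loopTo_induction`). -/

/-- `Conn x y S`: connectivity by the edges `x j — y j` with `j ∈ S`. -/
def Conn (x y : ℕ → ℕ) (S : Finset ℕ) : ℕ → ℕ → Prop :=
  Relation.EqvGen fun u v => ∃ j ∈ S, u = x j ∧ v = y j

namespace Conn

variable {x y : ℕ → ℕ} {S S' : Finset ℕ} {u v p : ℕ}

theorem refl (u : ℕ) : Conn x y S u u := Relation.EqvGen.refl u

theorem symm (h : Conn x y S u v) : Conn x y S v u := Relation.EqvGen.symm _ _ h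

theorem trans (h : Conn x y S u v) (h' : Conn x y S v p) : Conn x y S u p :=
  Relation.EqvGen.trans _ _ _ h h'

theorem of_mem {j : ℕ} (h : j ∈ S) : Conn x y S (x j) (y j) :=
  Relation.EqvGen.rel _ _ ⟨j, h, rfl, rfl⟩

theorem rec_equiv {r : ℕ → ℕ → Prop} (hr : Equivalence r) (h : ∀ j ∈ S, r (x j) (y j))
    (huv : Conn x y S u v) : r u v := by
  induction huv with
  | rel u v h' => obtain ⟨j, hj, rfl, rfl⟩ := h'; exact h j hj
  | refl u => exact hr.refl u
  | symm u v _ ih => exact hr.symm ih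
  | trans u v p _ _ ih ih' => exact hr.trans ih ih'

theorem equivalence : Equivalence (Conn x y S) := ⟨refl, symm, trans⟩

theorem of_forall_conn (h : ∀ j ∈ S, Conn x y S' (x j) (y j)) (huv : Conn x y S u v) :
    Conn x y S' u v :=
  rec_equiv equivalence h huv

theorem mono (h : S ⊆ S') (huv : Conn x y S u v) : Conn x y S' u v :=
  of_forall_conn (fun _ hj => of_mem (h hj)) huv

theorem empty_iff : Conn x y ∅ u v ↔ u = v :=
  ⟨rec_equiv eq_equivalence (by simp), fun h => h ▸ refl u⟩

/-- One more edge merges at most two classes. The right-hand side is shown to be an equivalence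
relation containing all the edges. This formula also justifies the relabelling in `components`. -/
theorem insert_iff {j : ℕ} : Conn x y (insert j S) u v ↔ Conn x y S u v ∨
    (Conn x y S u (x j) ∧ Conn x y S (y j) v) ∨ (Conn x y S u (y j) ∧ Conn x y S (x j) v) := by
  constructor
  · refine rec_equiv (r := fun u v => Conn x y S u v ∨
      (Conn x y S u (x j) ∧ Conn x y S (y j) v) ∨ (Conn x y S u (y j) ∧ Conn x y S (x j) v))
      ⟨fun u => .inl (refl u), ?_, ?_⟩ ?_
    · rintro u v (h | ⟨h, h'⟩ | ⟨h, h'⟩)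
      exacts [.inl h.symm, .inr (.inr ⟨h'.symm, h.symm⟩), .inr (.inl ⟨h'.symm, h.symm⟩)]
    · rintro u v p (h | ⟨h, h'⟩ | ⟨h, h'⟩) (k | ⟨k, k'⟩ | ⟨k, k'⟩)
      exacts [.inl (h.trans k), .inr (.inl ⟨h.trans k, k'⟩), .inr (.inr ⟨h.trans k, k'⟩),
        .inr (.inl ⟨h, h'.trans k⟩), .inr (.inl ⟨h, k'⟩), .inl (h.trans k'),
        .inr (.inr ⟨h, h'.trans k⟩), .inl (h.trans k'), .inr (.inr ⟨h, k'⟩)]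
    · intro i hi
      rcases Finset.mem_insert.1 hi with rfl | hi
      · exact .inr (.inl ⟨refl _, refl _⟩)
      · exact .inl (of_mem hi)
  · have hm : S ⊆ insert j S := Finset.subset_insert j S
    have hj : Conn x y (insert j S) (x j) (y j) := of_mem (Finset.mem_insert_self j S)
    rintro (h | ⟨h, h'⟩ | ⟨h, h'⟩)
    exacts [h.mono hm, (h.mono hm).trans (hj.trans (h'.mono hm)),
      (h.mono hm).trans (hj.symm.trans (h'.mono hm))]

/-- A connection between the two sides of a cut contains an edge of the cut. -/
theorem exists_not_conn (h : Conn x y S u v) (h' : ¬ Conn x y S' u v) :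
    ∃ j ∈ S, ¬ Conn x y S' (x j) (y j) := by
  by_contra hc
  push Not at hc
  exact h' (of_forall_conn hc h)

/-- Some set of pairwise unconnected vertices together with the edges is as large as the vertex
set. -/
theorem exists_pairwise_not_conn (x y : ℕ → ℕ) (n : ℕ) (S : Finset ℕ) :
    ∃ R ⊆ Finset.range n, (∀ u ∈ R, ∀ v ∈ R, Conn x y S u v → u = v) ∧ n ≤ R.card + S.card := by
  induction S using Finset.induction_on with
  | empty => exact ⟨Finset.range n, subset_rfl, fun u _ v _ h => empty_iff.1 h, by simp⟩
  | insert j S hj ih =>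
    classical
    obtain ⟨R, hR, hp, hc⟩ := ih
    refine ⟨R.filter fun u => ¬ Conn x y S u (y j), (Finset.filter_subset _ _).trans hR, ?_, ?_⟩
    · intro u hu v hv h
      rw [Finset.mem_filter] at hu hv
      rcases insert_iff.1 h with h | ⟨-, h⟩ | ⟨h, -⟩
      exacts [hp u hu.1 v hv.1 h, absurd h.symm hv.2, absurd h hu.2]
    · have h1 : (R.filter fun u => Conn x y S u (y j)).card ≤ 1 := by
        refine Finset.card_le_one.2 fun u hu v hv => ?_
        rw [Finset.mem_filter] at hu hv
        exact hp u hu.1 v hv.1 (hu.2.trans hv.2.symm)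
      have h2 := Finset.card_filter_add_card_filter_not (s := R) fun u => Conn x y S u (y j)
      rw [Finset.card_insert_of_notMem hj]
      lia

theorem le_card_add_one {n : ℕ} (h : ∀ u < n, ∀ v < n, Conn x y S u v) : n ≤ S.card + 1 := by
  obtain ⟨R, hR, hp, hc⟩ := exists_pairwise_not_conn x y n S
  have : R.card ≤ 1 := Finset.card_le_one.2 fun u hu v hv =>
    hp u hu v hv (h u (Finset.mem_range.1 (hR hu)) v (Finset.mem_range.1 (hR hv)))
  lia

/-- A connecting subset of least cardinality plays the role of a path, so that walks are never
needed. -/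
theorem exists_minimal (h : Conn x y S u v) :
    ∃ C ⊆ S, Conn x y C u v ∧ ∀ j ∈ C, ¬ Conn x y (C.erase j) u v := by
  classical
  obtain ⟨C, hC, hmin⟩ := Finset.exists_min_image (S.powerset.filter fun C => Conn x y C u v)
    Finset.card ⟨S, by simpa using h⟩
  rw [Finset.mem_filter, Finset.mem_powerset] at hC
  refine ⟨C, hC.1, hC.2, fun j hj hc => ?_⟩
  have := hmin (C.erase j) (by
    rw [Finset.mem_filter, Finset.mem_powerset]
    exact ⟨(Finset.erase_subset _ _).trans hC.1, hc⟩)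
  have := Finset.card_erase_lt_of_mem hj
  lia

/-- The two ends of an edge `j` of a minimal connection of the ends of `i` remain connected when
`j` is replaced by `i`. -/
theorem conn_insert_erase {i j : ℕ} {C : Finset ℕ} (h : Conn x y C (x i) (y i)) (hj : j ∈ C)
    (h' : ¬ Conn x y (C.erase j) (x i) (y i)) : Conn x y (insert i (C.erase j)) (x j) (y j) := by
  rw [← Finset.insert_erase hj, insert_iff] at h
  rw [insert_iff]
  rcases h with h | ⟨h, k⟩ | ⟨h, k⟩
  exacts [absurd h h', .inr (.inl ⟨h.symm, k.symm⟩), .inr (.inr ⟨k, h⟩)]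

end Conn

/-! ### Exchange of edges in spanning trees. -/

/-- The edges with numbers in `S` form a spanning tree on the vertices below `n`. -/
structure IsTreeSet (n m : ℕ) (x y : ℕ → ℕ) (S : Finset ℕ) : Prop where
  lt : ∀ j ∈ S, j < m
  card : S.card + 1 = n
  conn : ∀ u < n, ∀ v < n, Conn x y S u v

namespace IsTreeSet

variable {n m : ℕ} {x y : ℕ → ℕ} {A B S : Finset ℕ} {i j : ℕ}

/-- A set connecting the ends of all tree edges connects all vertices, so `Conn.le_card_add_one`
forbids it to be smaller than the tree. -/
theorem not_conn_of_card_lt (hB : IsTreeSet n m x y B) (h : S.card < B.card) :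
    ¬ ∀ j ∈ B, Conn x y S (x j) (y j) := by
  intro hc
  have := Conn.le_card_add_one (x := x) (y := y) (S := S) (n := n)
    fun u hu v hv => Conn.of_forall_conn hc (hB.conn u hu v hv)
  have := hB.card
  lia

theorem not_conn_erase (hB : IsTreeSet n m x y B) (hj : j ∈ B) :
    ¬ Conn x y (B.erase j) (x j) (y j) := by
  intro h
  refine hB.not_conn_of_card_lt (Finset.card_erase_lt_of_mem hj) fun i hi => ?_
  by_cases hij : i = j
  · exact hij ▸ h
  · exact Conn.of_mem (Finset.mem_erase.2 ⟨hij, hi⟩)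

theorem exchange_of_conn (hB : IsTreeSet n m x y B) (hj : j ∈ B) (hi : i < m) (hiB : i ∉ B.erase j)
    (h : Conn x y (insert i (B.erase j)) (x j) (y j)) :
    IsTreeSet n m x y (insert i (B.erase j)) where
  lt k hk := by
    rcases Finset.mem_insert.1 hk with rfl | hk
    exacts [hi, hB.lt k (Finset.mem_of_mem_erase hk)]
  card := by
    rw [Finset.card_insert_of_notMem hiB, Finset.card_erase_add_one hj, hB.card]
  conn u hu v hv := by
    refine Conn.of_forall_conn (fun k hk => ?_) (hB.conn u hu v hv)
    by_cases hkj : k = j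
    · exact hkj ▸ h
    · exact Conn.of_mem (Finset.mem_insert_of_mem (Finset.mem_erase.2 ⟨hkj, hk⟩))

/-- The new edge must cross the cut that the removal of `j` leaves. This turns the exchange test
into a comparison of two component labels. -/
theorem exchange_iff (hB : IsTreeSet n m x y B) (hj : j ∈ B) (hi : i < m) (hx : x i < n)
    (hy : y i < n) :
    IsTreeSet n m x y (insert i (B.erase j)) ↔ ¬ Conn x y (B.erase j) (x i) (y i) := by
  constructor
  · intro h hc
    refine h.not_conn_of_card_lt (S := B.erase j) ?_ fun k hk => ?_
    · have := h.card
      have := hB.card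
      have := Finset.card_erase_add_one hj
      lia
    · rcases Finset.mem_insert.1 hk with rfl | hk
      exacts [hc, Conn.of_mem hk]
  · intro h
    refine hB.exchange_of_conn hj hi (fun hi' => h (Conn.of_mem hi')) ?_
    exact Conn.conn_insert_erase (hB.conn _ hx _ hy) hj h

/-- Every edge outside a tree lies on a cycle with edges of the tree, each of which can be
exchanged for it. -/
theorem exists_cycle (hB : IsTreeSet n m x y B) (hi : i < m) (hiB : i ∉ B) (hx : x i < n)
    (hy : y i < n) : ∃ C ⊆ B, Conn x y C (x i) (y i) ∧
      ∀ j ∈ C, IsTreeSet n m x y (insert i (B.erase j)) := by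
  obtain ⟨C, hCB, hC, hmin⟩ := (hB.conn _ hx _ hy).exists_minimal
  refine ⟨C, hCB, hC, fun j hj => ?_⟩
  refine hB.exchange_of_conn (hCB hj) hi (fun h => hiB (Finset.mem_of_mem_erase h)) ?_
  exact (Conn.conn_insert_erase hC hj (hmin j hj)).mono
    (Finset.insert_subset_insert _ (Finset.erase_subset_erase _ hCB))

end IsTreeSet

/-! ### Families of sets with the symmetric exchange property -/

/-- The symmetric exchange property of the bases of a matroid. -/
def SymmExchange (F : Finset ℕ → Prop) : Prop :=
  ∀ A B, F A → F B → ∀ i ∈ B, i ∉ A →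
    ∃ j ∈ A, j ∉ B ∧ F (insert i (A.erase j)) ∧ F (insert j (B.erase i))

/-- Removing `i` from `B` leaves a cut that separates the ends of `i`. The part in `A` of the cycle
closed by `i` connects these ends, so it contains an edge `j` across the cut; this `j` serves both
trees. -/
theorem symmExchange_isTreeSet {n m : ℕ} {x y : ℕ → ℕ} (hx : ∀ j < m, x j < n)
    (hy : ∀ j < m, y j < n) : SymmExchange (IsTreeSet n m x y) := by
  intro A B hA hB i hi hiA
  have him := hB.lt i hi
  obtain ⟨C, hCA, hC, hex⟩ := hA.exists_cycle him hiA (hx i him) (hy i him)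
  obtain ⟨j, hj, hcut⟩ := hC.exists_not_conn (hB.not_conn_erase hi)
  have hjm := hA.lt j (hCA hj)
  refine ⟨j, hCA hj, fun hjB => hcut (Conn.of_mem (Finset.mem_erase.2 ⟨?_, hjB⟩)), hex j hj,
    (hB.exchange_iff hi hjm (hx j hjm) (hy j hjm)).2 hcut⟩
  rintro rfl
  exact hiA (hCA hj)

/-- The members of `F` of minimum weight. -/
def MinWeight (F : Finset ℕ → Prop) (c : ℕ → ℝ) (A : Finset ℕ) : Prop :=
  F A ∧ ∀ B, F B → ∑ j ∈ A, c j ≤ ∑ j ∈ B, c j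

theorem sum_insert_erase {A : Finset ℕ} {i j : ℕ} (c : ℕ → ℝ) (hj : j ∈ A) (hi : i ∉ A) :
    ∑ k ∈ insert i (A.erase j), c k = ∑ k ∈ A, c k + c i - c j := by
  rw [Finset.sum_insert fun h => hi (Finset.mem_of_mem_erase h), ← Finset.add_sum_erase A c hj]
  ring

namespace SymmExchange

variable {F : Finset ℕ → Prop} {c : ℕ → ℝ} {A B : Finset ℕ} {i j k l : ℕ}

/-- The two exchanges change the weights by opposite amounts, and neither can lower a minimum, so
both changes are zero. -/
theorem minWeight (hF : SymmExchange F) (c : ℕ → ℝ) : SymmExchange (MinWeight F c) := by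
  intro A B hA hB i hi hiA
  obtain ⟨j, hj, hjB, h1, h2⟩ := hF A B hA.1 hB.1 i hi hiA
  have e1 := sum_insert_erase c hj hiA
  have e2 := sum_insert_erase c hi hjB
  have l1 := hA.2 _ h1
  have l2 := hB.2 _ h2
  have l3 := hA.2 _ hB.1
  have l4 := hB.2 _ hA.1
  refine ⟨j, hj, hjB, ⟨h1, fun D hD => ?_⟩, h2, fun D hD => ?_⟩
  · have := hA.2 D hD
    linarith
  · have := hB.2 D hD
    linarith

/-- A member of `F` that no single exchange improves has minimum weight. -/
theorem minWeight_of_local (hF : SymmExchange F) (hA : F A)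
    (h : ∀ j ∈ A, ∀ i ∉ A, F (insert i (A.erase j)) → c j ≤ c i) : MinWeight F c A := by
  refine ⟨hA, fun B hB => ?_⟩
  induction hs : (B \ A).card generalizing B with
  | zero =>
    have hsub : B ⊆ A := by
      rwa [Finset.card_eq_zero, Finset.sdiff_eq_empty_iff_subset] at hs
    have : B = A := by
      by_contra hne
      obtain ⟨i, hi, hiB⟩ := Finset.exists_of_ssubset (hsub.ssubset_of_ne hne)
      obtain ⟨j, hj, hjA, -⟩ := hF B A hB hA i hi hiB
      exact hjA (hsub hj)
    rw [this]
  | succ s ih =>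
    obtain ⟨i, hi⟩ : (B \ A).Nonempty := Finset.card_pos.1 (by lia)
    rw [Finset.mem_sdiff] at hi
    -- The exchange brings `B` closer to `A`. Local optimality, applied to the companion exchange in
    -- `A`, shows that it does not raise the weight of `B`.
    obtain ⟨j, hj, hjB, h1, h2⟩ := hF A B hA hB i hi.1 hi.2
    have e2 := sum_insert_erase c hi.1 hjB
    have := h j hj i hi.2 h1
    have := ih _ h2 (by
      have : insert j (B.erase i) \ A = (B \ A).erase i := by
        ext k
        simp only [Finset.mem_sdiff, Finset.mem_insert, Finset.mem_erase]
        constructor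
        · rintro ⟨rfl | hk, hkA⟩
          exacts [absurd hj hkA, ⟨hk.1, hk.2, hkA⟩]
        · rintro ⟨h1, h2, h3⟩
          exact ⟨.inr ⟨h1, h2⟩, h3⟩
      rw [this, Finset.card_erase_of_mem (Finset.mem_sdiff.2 hi), hs]
      rfl)
    linarith

/-- After the exchange of `j` for `i`, the exchange of `l` for `k` is possible if it was possible
before and that of `j` for `k` was not. -/
theorem exchange_exchange (hF : SymmExchange F) (hi : i ∉ A) (hj : j ∈ A) (hk : k ∉ A)
    (hl : l ∈ A) (hik : i ≠ k) (hjl : j ≠ l) (hij : F (insert i (A.erase j)))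
    (hkj : ¬ F (insert k (A.erase j))) (hkl : F (insert k (A.erase l))) :
    F (insert k ((insert i (A.erase j)).erase l)) := by
  -- Exchange between `A - j + i` and `A - l + k`: the partner of `j` can only be `i` or `l`. The
  -- first gives the claim, the second would give `A - j + k`.
  obtain ⟨p, hp, hp', -, h⟩ := hF _ _ hij hkl j
    (Finset.mem_insert_of_mem (Finset.mem_erase.2 ⟨hjl, hj⟩))
    (by simp only [Finset.mem_insert, Finset.mem_erase]; grind)
  have hp2 : p = i ∨ p = l := by grind
  rcases hp2 with rfl | rfl
  · convert h using 1
    ext q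
    simp only [Finset.mem_insert, Finset.mem_erase]
    grind
  · exfalso
    apply hkj
    convert h using 1
    ext q
    simp only [Finset.mem_insert, Finset.mem_erase]
    grind

/-- Only `j` and `l` can have left `A`, so bringing `k` back into `A` by symmetric exchange would
have to remove one of these two. -/
theorem not_exchange_exchange (hF : SymmExchange F) (hA : F A) (hj : j ∈ A) (hk : k ∉ A)
    (hl : l ∈ A) (hjl : j ≠ l) (hkj : ¬ F (insert k (A.erase j)))
    (hkl : ¬ F (insert k (A.erase l))) :
    ¬ F (insert k ((insert i (A.erase j)).erase l)) := by
  intro hB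
  obtain ⟨p, hp, hp', h, -⟩ := hF _ _ hA hB k (Finset.mem_insert_self _ _) hk
  have hp2 : p = j ∨ p = l := by grind
  rcases hp2 with rfl | rfl
  exacts [hkj h, hkl h]

end SymmExchange

end GDC

/-! ### Spanning trees with bounds on the number of edges of each colour -/

namespace GDC

/-- A graph with the vertices below `n` and the edges `x j — y j` for `j < m`, of weight `w j` and
colour `col j`, where at most `up c + 1` edges of colour `c` are allowed. -/
structure Net where
  n : ℕ
  m : ℕ
  x : ℕ → ℕ
  y : ℕ → ℕ
  up : ℕ → ℕ
  col : ℕ → ℕ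
  w : ℕ → ℝ
  x_lt : ∀ j < m, x j < n
  y_lt : ∀ j < m, y j < n
  col_lt : ∀ j < m, col j < m

namespace Net

variable (N : Net)

def Tree (S : Finset ℕ) : Prop := IsTreeSet N.n N.m N.x N.y S

def count (c : ℕ) (S : Finset ℕ) : ℕ := (S.filter fun j => N.col j = c).card

/-- The summand `1` accounts for the edge itself, which is not among its own dependencies. -/
def Feasible (S : Finset ℕ) : Prop := N.Tree S ∧ ∀ c < N.m, N.count c S ≤ N.up c + 1

/-- The weights modified by a penalty for each colour. -/
def cost (lam : ℕ → ℝ) (j : ℕ) : ℝ := N.w j + lam (N.col j)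

def MinTree (lam : ℕ → ℝ) (S : Finset ℕ) : Prop := MinWeight N.Tree (N.cost lam) S

/-- The number of edges beyond the bounds. -/
def excess (S : Finset ℕ) : ℕ := ∑ c ∈ Finset.range N.m, (N.count c S - (N.up c + 1))

/-- The penalties are nonnegative and zero on the colours that are not used up, and the tree is
optimal for the modified weights. -/
structure Dual (lam : ℕ → ℝ) (S : Finset ℕ) : Prop where
  minTree : N.MinTree lam S
  nonneg : ∀ c < N.m, 0 ≤ lam c
  slack : ∀ c < N.m, lam c ≠ 0 → N.up c + 1 ≤ N.count c S

variable {N} {lam lam' : ℕ → ℝ} {S T T' : Finset ℕ} {i j c e f : ℕ}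

theorem symmExchange_tree : SymmExchange N.Tree := symmExchange_isTreeSet N.x_lt N.y_lt

theorem symmExchange_minTree : SymmExchange (N.MinTree lam) := symmExchange_tree.minWeight _

theorem MinTree.tree (h : N.MinTree lam S) : N.Tree S := h.1

theorem sum_col (hS : N.Tree S) (g : ℕ → ℝ) :
    ∑ j ∈ S, g (N.col j) = ∑ c ∈ Finset.range N.m, N.count c S * g c := by
  rw [← Finset.sum_fiberwise_of_maps_to (t := Finset.range N.m) (g := N.col)
    fun j hj => Finset.mem_range.2 (N.col_lt j (hS.lt j hj))]
  refine Finset.sum_congr rfl fun c _ => ?_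
  rw [Finset.sum_congr rfl fun j hj => by rw [(Finset.mem_filter.1 hj).2], Finset.sum_const,
    nsmul_eq_mul, count]

/-- Complementary slackness: a feasible tree with suitable penalties is optimal. -/
theorem Dual.weight_le (h : N.Dual lam T) (hT : N.Feasible T) (hT' : N.Feasible T') :
    ∑ j ∈ T, N.w j ≤ ∑ j ∈ T', N.w j := by
  have h1 := h.minTree.2 T' hT'.1
  simp only [cost, Finset.sum_add_distrib, sum_col hT.1, sum_col hT'.1] at h1
  have h2 : ∑ c ∈ Finset.range N.m, (N.count c T' : ℝ) * lam c ≤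
      ∑ c ∈ Finset.range N.m, (N.count c T : ℝ) * lam c := by
    refine Finset.sum_le_sum fun c hc => ?_
    have hc := Finset.mem_range.1 hc
    by_cases h0 : lam c = 0
    · simp [h0]
    · refine mul_le_mul_of_nonneg_right ?_ (h.nonneg c hc)
      exact_mod_cast (hT'.2 c hc).trans (h.slack c hc h0)
  linarith

/-- If no exchange moves an edge out of a set of colours that are all used up, and one of these
colours is overused, then there is no feasible tree. -/
theorem not_feasible (hT : N.Tree T) {P : ℕ → Prop}
    (hP : ∀ e ∈ T, ∀ f < N.m, N.Tree (insert f (T.erase e)) → P (N.col e) → P (N.col f))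
    (hup : ∀ c < N.m, P c → N.up c + 1 ≤ N.count c T)
    (hc : c < N.m) (hPc : P c) (hover : N.up c + 1 < N.count c T) : ¬ N.Feasible T' := by
  classical
  intro hT'
  -- For these weights a tree weighs the number of its edges with colours in `P`. No exchange out of
  -- `P` is possible, hence `T` is a local and so a global minimum.
  have h1 : MinWeight N.Tree (fun j => if P (N.col j) then (1 : ℝ) else 0) T := by
    refine symmExchange_tree.minWeight_of_local hT fun e he f _ hef => ?_
    have := hP e he f (hef.lt f (Finset.mem_insert_self _ _)) hef
    split_ifs with h1 h2
    exacts [le_rfl, absurd (this h1) h2, zero_le_one, le_rfl]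
  have h2 := h1.2 T' hT'.1
  rw [sum_col hT fun c => if P c then (1 : ℝ) else 0,
    sum_col hT'.1 fun c => if P c then (1 : ℝ) else 0] at h2
  -- Colour by colour a feasible tree has at most as many edges in `P` as `T`, and strictly fewer of
  -- the overused colour `c`.
  refine absurd h2 (not_le.2 (Finset.sum_lt_sum (fun b hb => ?_) ⟨c, Finset.mem_range.2 hc, ?_⟩))
  · split_ifs with h
    · have hb := Finset.mem_range.1 hb
      rw [mul_one, mul_one]
      exact_mod_cast (hT'.2 b hb).trans (hup b hb h)
    · simp
  · rw [if_pos hPc, mul_one, mul_one]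
    exact_mod_cast (hT'.2 c hc).trans_lt hover

/-! ### Growing a minimum tree greedily. -/

theorem tree_of_connected {T : Finset ℕ} (hT : ∀ j ∈ T, j < N.m) (hcard : T.card + 1 ≤ N.n)
    (h : ∀ u < N.n, ∀ v < N.n, Conn N.x N.y T u v) : N.Tree T :=
  ⟨hT, hcard.antisymm (Conn.le_card_add_one h), h⟩

/-- The cut property: the cycle that `f` closes in `S` has another edge between components of `T`.
It is no lighter than `f`, so replacing it by `f` keeps the tree minimal. -/
theorem MinTree.exists_insert (hS : N.MinTree lam S) (hTS : T ⊆ S) (hf : f < N.m)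
    (hfT : ¬ Conn N.x N.y T (N.x f) (N.y f))
    (hmin : ∀ j < N.m, ¬ Conn N.x N.y T (N.x j) (N.y j) → N.cost lam f ≤ N.cost lam j) :
    ∃ S', N.MinTree lam S' ∧ insert f T ⊆ S' := by
  by_cases hfS : f ∈ S
  · exact ⟨S, hS, Finset.insert_subset hfS hTS⟩
  obtain ⟨C, hCS, hC, hex⟩ := hS.tree.exists_cycle hf hfS (N.x_lt f hf) (N.y_lt f hf)
  obtain ⟨j, hj, hjT⟩ := hC.exists_not_conn hfT
  have hTS' : T ⊆ S.erase j := fun i hi => Finset.mem_erase.2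
    ⟨fun hij => hjT (hij ▸ Conn.of_mem hi), hTS hi⟩
  refine ⟨_, ⟨hex j hj, fun B hB => ?_⟩, Finset.insert_subset_insert f hTS'⟩
  have h1 := hmin j (hS.tree.lt j (hCS hj)) hjT
  have h2 := hS.2 B hB
  rw [sum_insert_erase _ (hCS hj) hfS]
  linarith

theorem Tree.exists_not_conn (hS : N.Tree S) (hcard : T.card + 1 < N.n) :
    ∃ j < N.m, ¬ Conn N.x N.y T (N.x j) (N.y j) := by
  have h := hS.not_conn_of_card_lt (S := T) (by have := hS.card; lia)
  push Not at h
  obtain ⟨j, hj, h⟩ := h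
  exact ⟨j, hS.lt j hj, h⟩

theorem exists_minTree (lam : ℕ → ℝ) (hS : N.Tree S) : ∃ T, N.MinTree lam T := by
  classical
  obtain ⟨T, hT, hmin⟩ := Finset.exists_min_image
    ((Finset.range N.m).powerset.filter N.Tree) (fun T => ∑ j ∈ T, N.cost lam j)
    ⟨S, by
      rw [Finset.mem_filter, Finset.mem_powerset]
      exact ⟨fun j hj => Finset.mem_range.2 (hS.lt j hj), hS⟩⟩
  rw [Finset.mem_filter] at hT
  refine ⟨T, hT.2, fun B hB => hmin B ?_⟩
  rw [Finset.mem_filter, Finset.mem_powerset]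
  exact ⟨fun j hj => Finset.mem_range.2 (hB.lt j hj), hB⟩

/-! ### The search for an augmenting path of colours -/

variable (N) in
/-- The exchange of the edge `e` of `T` for the edge `f` yields a tree. -/
structure Arc (T : Finset ℕ) (e f : ℕ) : Prop where
  mem : e ∈ T
  lt : f < N.m
  tree : N.Tree (insert f (T.erase e))

theorem Arc.lt_left (h : N.Arc T e f) (hT : N.Tree T) : e < N.m := hT.lt e h.mem

/-- An exchange for another edge of `T` would lose an edge; only the trivial exchange stays inside
`T`. -/
theorem Arc.notMem (h : N.Arc T e f) (hT : N.Tree T) (hne : e ≠ f) : f ∉ T := by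
  intro hf
  have h1 := h.tree.card
  have h2 := hT.card
  rw [Finset.insert_eq_of_mem (Finset.mem_erase.2 ⟨hne.symm, hf⟩)] at h1
  have := Finset.card_erase_add_one h.mem
  lia

theorem MinTree.cost_le (h : N.MinTree lam T) (hef : N.Arc T e f) :
    N.cost lam e ≤ N.cost lam f := by
  by_cases hne : e = f
  · rw [hne]
  have := h.2 _ hef.tree
  rw [sum_insert_erase _ hef.mem (hef.notMem h.1 hne)] at this
  linarith

/-- Single exchanges within the family of minimum trees are exactly the tight arcs. This translates
between the search, which speaks of costs, and the exchange lemmas for `SymmExchange`. -/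
theorem MinTree.minTree_insert_erase_iff (h : N.MinTree lam T) (he : e ∈ T) (hf : f < N.m)
    (hne : f ∉ T) :
    N.MinTree lam (insert f (T.erase e)) ↔ N.Arc T e f ∧ N.cost lam f = N.cost lam e := by
  have hs := sum_insert_erase (N.cost lam) he hne
  constructor
  · intro h'
    have := h'.2 T h.1
    have := h.2 _ h'.1
    exact ⟨⟨he, hf, h'.1⟩, by linarith⟩
  · rintro ⟨hef, hc⟩
    refine ⟨hef.tree, fun B hB => ?_⟩
    have := h.2 B hB
    linarith

variable (N) in
/-- The state of the search. The reached colours `c` are those with `ord c ≠ 0`; `ord c = 1` means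
that `c` is not used up, and otherwise the exchange of `pe c` for `pf c` leads from `c` to a
colour reached earlier. -/
structure Search (T : Finset ℕ) (ord : ℕ → ℕ) (lam : ℕ → ℝ) (pe pf : ℕ → ℕ) (r : ℕ) : Prop where
  dual : N.Dual lam T
  ord_eq_one : ∀ c < N.m, ord c = 1 ↔ N.count c T ≤ N.up c
  ord_le : ∀ c < N.m, ord c ≤ r + 1
  col_pe : ∀ c < N.m, 2 ≤ ord c → N.col (pe c) = c
  arc : ∀ c < N.m, 2 ≤ ord c → N.Arc T (pe c) (pf c)
  cost_eq : ∀ c < N.m, 2 ≤ ord c → N.cost lam (pf c) = N.cost lam (pe c)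
  pos : ∀ c < N.m, 2 ≤ ord c → 1 ≤ ord (N.col (pf c))
  lt : ∀ c < N.m, 2 ≤ ord c → ord (N.col (pf c)) < ord c
  -- Among the tight exchanges out of a reached colour, the recorded one leads to a colour of least
  -- order. This is the source of triangularity.
  first : ∀ e f, N.Arc T e f → 2 ≤ ord (N.col e) → 1 ≤ ord (N.col f) →
    N.cost lam f = N.cost lam e → ord (N.col (pf (N.col e))) ≤ ord (N.col f)
  -- Either the search is stuck, or every round so far has reached a new colour.
  progress : (∀ e f, N.Arc T e f → ord (N.col e) = 0 → ord (N.col f) = 0) ∨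
    r ≤ ((Finset.range N.m).filter fun c => 1 ≤ ord c).card

variable {ord ord' pe pf pe' pf' : ℕ → ℕ} {r : ℕ}

theorem Search.init (h : N.Dual lam T)
    (hord : ∀ c < N.m, ord c = if N.count c T ≤ N.up c then 1 else 0) :
    N.Search T ord lam pe pf 0 := by
  have h2 : ∀ c < N.m, ¬ 2 ≤ ord c := fun c hc h => by
    rw [hord c hc] at h
    split_ifs at h <;> lia
  refine ⟨h, fun c hc => ?_, fun c hc => ?_, fun c hc h => absurd h (h2 c hc),
    fun c hc h => absurd h (h2 c hc), fun c hc h => absurd h (h2 c hc),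
    fun c hc h => absurd h (h2 c hc), fun c hc h => absurd h (h2 c hc), fun e f hef h' => ?_,
    .inr (Nat.zero_le _)⟩
  · rw [hord c hc]
    simp
  · have := h2 c hc
    lia
  · exact absurd h' (h2 _ (N.col_lt e (hef.lt_left h.minTree.1)))

theorem Search.stay (h : N.Search T ord lam pe pf r)
    (hno : ∀ e f, N.Arc T e f → ord (N.col e) = 0 → ord (N.col f) = 0) :
    N.Search T ord lam pe pf (r + 1) :=
  { h with
    ord_le := fun c hc => (h.ord_le c hc).trans (Nat.le_succ _)
    progress := .inl hno }

/-- Raising the penalties of unreached colours by `d` affects only arcs between unreached and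
reached colours. Those towards reached colours have slack at least `d` by minimality, those in the
other direction gain slack, and the chosen arc becomes tight. The order `r + 2` exceeds all earlier
ones. -/
theorem Search.extend (h : N.Search T ord lam pe pf r) (hef : N.Arc T e f)
    (he : ord (N.col e) = 0) (hf : 1 ≤ ord (N.col f))
    (hmin : ∀ e' f', N.Arc T e' f' → ord (N.col e') = 0 → 1 ≤ ord (N.col f') →
      N.cost lam f - N.cost lam e ≤ N.cost lam f' - N.cost lam e' ∧
      (N.cost lam f' - N.cost lam e' = N.cost lam f - N.cost lam e →
        ord (N.col f) ≤ ord (N.col f')))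
    (hlam : ∀ c < N.m, lam' c =
      if ord c = 0 then lam c + (N.cost lam f - N.cost lam e) else lam c) :
    N.Search T (Function.update ord (N.col e) (r + 2)) lam' (Function.update pe (N.col e) e)
      (Function.update pf (N.col e) f) (r + 1) := by
  have hT := h.dual.minTree.1
  have hem := hef.lt_left hT
  set d := N.cost lam f - N.cost lam e with hd
  have hd0 : 0 ≤ d := sub_nonneg.2 (h.dual.minTree.cost_le hef)
  have hc : ∀ j < N.m, N.cost lam' j = N.cost lam j + if ord (N.col j) = 0 then d else 0 := by
    intro j hj
    rw [cost, cost, hlam _ (N.col_lt j hj)]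
    split_ifs <;> ring
  have hce := N.col_lt e hem
  have hcf := N.col_lt f hef.lt
  have hne : N.col f ≠ N.col e := fun h' => by rw [h'] at hf; lia
  have old : ∀ c, ord c ≠ 0 → c ≠ N.col e := fun c h' hc' => h' (hc' ▸ he)
  refine ⟨⟨?_, ?_, ?_⟩, ?_, ?_, ?_, ?_, ?_, ?_, ?_, ?_, ?_⟩
  · refine symmExchange_tree.minWeight_of_local hT fun e' he' f' _ hef' => ?_
    have ha : N.Arc T e' f' := ⟨he', hef'.lt f' (Finset.mem_insert_self _ _), hef'⟩
    have h1 := h.dual.minTree.cost_le ha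
    rw [hc e' (ha.lt_left hT), hc f' ha.lt]
    split_ifs with h2 h3 h3
    · linarith
    · linarith [(hmin e' f' ha h2 (by lia)).1]
    · linarith
    · linarith
  · intro c hcm
    have := h.dual.nonneg c hcm
    rw [hlam c hcm]
    split_ifs <;> linarith
  · intro c hcm h0
    have h1 := h.ord_eq_one c hcm
    rw [hlam c hcm] at h0
    split_ifs at h0 with h2
    -- A raised colour is unreached, so its order is not `1` and it is used up.
    · by_contra h3
      have := h1.2 (by lia)
      lia
    · exact h.dual.slack c hcm h0
  · intro c hcm
    by_cases hce' : c = N.col e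
    · have := h.ord_eq_one c hcm
      subst hce'
      rw [Function.update_self]
      lia
    · rw [Function.update_of_ne hce']
      exact h.ord_eq_one c hcm
  · intro c hcm
    by_cases hce' : c = N.col e
    · subst hce'
      rw [Function.update_self]
    · rw [Function.update_of_ne hce']
      exact (h.ord_le c hcm).trans (Nat.le_succ _)
  · intro c hcm h2
    by_cases hce' : c = N.col e
    · subst hce'
      rw [Function.update_self]
    · rw [Function.update_of_ne hce'] at h2 ⊢
      exact h.col_pe c hcm h2
  · intro c hcm h2
    by_cases hce' : c = N.col e
    · subst hce'
      rwa [Function.update_self, Function.update_self]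
    · rw [Function.update_of_ne hce'] at h2 ⊢
      rw [Function.update_of_ne hce']
      exact h.arc c hcm h2
  · intro c hcm h2
    by_cases hce' : c = N.col e
    · subst hce'
      rw [Function.update_self, Function.update_self, hc e hem, hc f hef.lt, if_pos he,
        if_neg (by lia)]
      linarith
    · rw [Function.update_of_ne hce'] at h2 ⊢
      rw [Function.update_of_ne hce']
      have ha := h.arc c hcm h2
      have h3 := h.col_pe c hcm h2
      have h4 := h.pos c hcm h2
      rw [hc _ ha.lt, hc _ (ha.lt_left hT), h.cost_eq c hcm h2, if_neg (by lia), h3,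
        if_neg (by lia)]
  · intro c hcm h2
    by_cases hce' : c = N.col e
    · subst hce'
      rwa [Function.update_self, Function.update_of_ne hne]
    · rw [Function.update_of_ne hce'] at h2 ⊢
      have := h.pos c hcm h2
      rwa [Function.update_of_ne (old _ (by lia))]
  · intro c hcm h2
    by_cases hce' : c = N.col e
    · subst hce'
      rw [Function.update_self, Function.update_of_ne hne, Function.update_self]
      have := h.ord_le _ hcf
      lia
    · rw [Function.update_of_ne hce'] at h2
      rw [Function.update_of_ne hce', Function.update_of_ne hce']
      have := h.pos c hcm h2
      rw [Function.update_of_ne (old _ (by lia))]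
      exact h.lt c hcm h2
  -- For the new colour the tie-breaking rule in `hmin` applies. For older colours, only arcs into
  -- the new colour are new targets, and its order is the largest.
  · intro e' f' ha h2 h1 heq
    have hcm := N.col_lt e' (ha.lt_left hT)
    have hcm' := N.col_lt f' ha.lt
    have hle : ord (N.col f) ≤ r + 1 := h.ord_le _ hcf
    by_cases hce' : N.col e' = N.col e
    · rw [hce', Function.update_self, Function.update_of_ne hne]
      by_cases hcf' : N.col f' = N.col e
      · rw [hcf', Function.update_self]
        lia
      · rw [Function.update_of_ne hcf'] at h1 ⊢
        rw [hc _ (ha.lt_left hT), hc _ ha.lt, hce', if_neg (by lia), if_pos he] at heq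
        exact (hmin e' f' ha (by rw [hce', he]) h1).2 (by linarith)
    · rw [Function.update_of_ne hce'] at h2
      have h3 := h.pos _ hcm h2
      rw [Function.update_of_ne hce', Function.update_of_ne (old _ (by lia))]
      by_cases hcf' : N.col f' = N.col e
      · rw [hcf', Function.update_self]
        have := h.lt _ hcm h2
        have := h.ord_le _ hcm
        lia
      · rw [Function.update_of_ne hcf'] at h1 ⊢
        rw [hc _ (ha.lt_left hT), hc _ ha.lt, if_neg (by lia), if_neg (by lia)] at heq
        exact h.first e' f' ha h2 h1 (by linarith)
  · right
    rcases h.progress with h' | h'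
    · have := h' e f hef he
      lia
    · have hsub : insert (N.col e) ((Finset.range N.m).filter fun c => 1 ≤ ord c) ⊆
          (Finset.range N.m).filter fun c =>
            1 ≤ Function.update ord (N.col e) (r + 2) c := by
        intro c hcm
        rw [Finset.mem_insert, Finset.mem_filter, Finset.mem_range] at hcm
        rw [Finset.mem_filter, Finset.mem_range]
        by_cases hce' : c = N.col e
        · subst hce'
          rw [Function.update_self]
          exact ⟨hce, by lia⟩
        · rw [Function.update_of_ne hce']
          tauto
      have := Finset.card_le_card hsub
      rw [Finset.card_insert_of_notMem (by
        rw [Finset.mem_filter]; lia)] at this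
      lia

/-- A complete search that does not reach some overused colour shows infeasibility. -/
theorem Search.not_feasible (h : N.Search T ord lam pe pf N.m) (hc : c < N.m)
    (hover : N.up c + 1 < N.count c T) (h0 : ord c = 0) : ¬ N.Feasible T' := by
  refine Net.not_feasible (P := fun c => ord c = 0) h.dual.minTree.1 (fun e he f hf hef h1 => ?_)
    (fun b hb hb0 => ?_) hc h0 hover
  -- If the search is stuck, the unreached colours are closed under exchanges; otherwise all `m`
  -- colours would have been reached, including `c`.
  · rcases h.progress with h' | h'
    · exact h' e f ⟨he, hf, hef⟩ h1
    · exfalso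
      have : ((Finset.range N.m).filter fun c => 1 ≤ ord c).card < (Finset.range N.m).card := by
        refine Finset.card_lt_card ⟨Finset.filter_subset _ _, fun hs => ?_⟩
        have := (Finset.mem_filter.1 (hs (Finset.mem_range.2 hc))).2
        lia
      rw [Finset.card_range] at this
      lia
  · have := h.ord_eq_one b hb
    by_contra h3
    have := this.2 (by lia)
    lia

/-! ### Augmentation along a path of colours -/

variable (N) in
/-- The tree `S` arises from `T` by the exchanges on the path from the colour `c₀` to `cur`. -/
structure Walk (T : Finset ℕ) (ord : ℕ → ℕ) (lam : ℕ → ℝ) (pe pf : ℕ → ℕ) (c₀ : ℕ) (S : Finset ℕ)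
    (cur : ℕ) : Prop where
  minTree : N.MinTree lam S
  count : ∀ c, N.count c S + (if c = c₀ then 1 else 0) =
    N.count c T + if c = cur then 1 else 0
  cur_lt : cur < N.m
  pos : 1 ≤ ord cur
  mem : ∀ c < N.m, 2 ≤ ord c → ord c ≤ ord cur → pe c ∈ S
  notMem : ∀ c < N.m, 2 ≤ ord c → ord c ≤ ord cur → pf c ∉ S
  exchange : ∀ c < N.m, 2 ≤ ord c → ord c ≤ ord cur → N.MinTree lam (insert (pf c) (S.erase (pe c)))
  triangular : ∀ c < N.m, 2 ≤ ord c → ord c ≤ ord cur → ∀ c' < N.m, 2 ≤ ord c' →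
    ord c' ≤ ord cur → ord (N.col (pf c')) < ord (N.col (pf c)) →
    ¬ N.MinTree lam (insert (pf c') (S.erase (pe c)))

theorem Search.arc_ne (h : N.Search T ord lam pe pf r) (hc : c < N.m) (h2 : 2 ≤ ord c) :
    pe c ≠ pf c := by
  intro he
  have h1 := h.col_pe c hc h2
  have h3 := h.lt c hc h2
  rw [← he, h1] at h3
  lia

/-- Triangularity at the start: a minimum tree obtained from `pe c` and `pf c'` would be a tight
exchange out of `c` to a colour of smaller order than the recorded one, against `first`. -/
theorem Search.walk (h : N.Search T ord lam pe pf r) (hc : c < N.m) (hpos : 1 ≤ ord c) :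
    N.Walk T ord lam pe pf c T c := by
  have hT := h.dual.minTree
  have hmem : ∀ c < N.m, 2 ≤ ord c → pf c ∉ T := fun c hc h2 =>
    (h.arc c hc h2).notMem hT.1 (h.arc_ne hc h2)
  refine ⟨hT, fun _ => rfl, hc, hpos, fun c hc h2 _ => (h.arc c hc h2).mem,
    fun c hc h2 _ => hmem c hc h2, fun c hc h2 _ => ?_, fun c hc h2 _ c' hc' h2' _ hlt hmin => ?_⟩
  · exact (hT.minTree_insert_erase_iff (h.arc c hc h2).mem (h.arc c hc h2).lt (hmem c hc h2)).2
      ⟨h.arc c hc h2, h.cost_eq c hc h2⟩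
  · obtain ⟨ha, hcost⟩ := (hT.minTree_insert_erase_iff (h.arc c hc h2).mem (h.arc c' hc' h2').lt
      (hmem c' hc' h2')).1 hmin
    have := h.first _ _ ha (by rwa [h.col_pe c hc h2]) (h.pos c' hc' h2') hcost
    rw [h.col_pe c hc h2] at this
    lia

/-- The corrections are added on both sides to avoid truncated subtraction; equal colours of `e` and
`f` need no separate case. -/
theorem count_insert_erase (he : e ∈ S) (hf : f ∉ S) (c : ℕ) :
    N.count c (insert f (S.erase e)) + (if c = N.col e then 1 else 0) =
      N.count c S + if c = N.col f then 1 else 0 := by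
  have hsum : ∀ A : Finset ℕ, N.count c A = ∑ j ∈ A, if N.col j = c then 1 else 0 := fun A => by
    rw [count, Finset.card_filter]
  rw [hsum, hsum, Finset.sum_insert fun h => hf (Finset.mem_of_mem_erase h),
    ← Finset.add_sum_erase S _ he]
  simp only [eq_comm (a := c)]
  ring

/-- For colours `c` further down the path, `pf c` cannot replace `pe cur` by triangularity. Under
this condition the exchange at `cur` preserves both the possible and the impossible exchanges among
the remaining colours. -/
theorem Walk.step {c₀ cur : ℕ} (h : N.Search T ord lam pe pf r)
    (hw : N.Walk T ord lam pe pf c₀ S cur) (h2 : 2 ≤ ord cur) :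
    N.Walk T ord lam pe pf c₀ (insert (pf cur) (S.erase (pe cur))) (N.col (pf cur)) := by
  have hm := hw.cur_lt
  have he := hw.mem cur hm h2 le_rfl
  have hf := hw.notMem cur hm h2 le_rfl
  have hlt := h.lt cur hm h2
  have hij := hw.exchange cur hm h2 le_rfl
  have hpe : ∀ c < N.m, 2 ≤ ord c → ord c ≤ ord (N.col (pf cur)) → pe cur ≠ pe c := by
    intro c hc hc2 hle heq
    have h1 := h.col_pe c hc hc2
    rw [← heq, h.col_pe cur hm h2] at h1
    subst h1
    lia
  have hpf : ∀ c < N.m, 2 ≤ ord c → ord c ≤ ord (N.col (pf cur)) → pf cur ≠ pf c := by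
    intro c hc hc2 hle heq
    have h1 := h.lt c hc hc2
    rw [← heq] at h1
    lia
  have hno : ∀ c < N.m, 2 ≤ ord c → ord c ≤ ord (N.col (pf cur)) →
      ¬ N.MinTree lam (insert (pf c) (S.erase (pe cur))) := fun c hc hc2 hle =>
    hw.triangular cur hm h2 le_rfl c hc hc2 (by lia) ((h.lt c hc hc2).trans_le hle)
  refine ⟨hij, fun c => ?_, N.col_lt _ (h.arc cur hm h2).lt, h.pos cur hm h2,
    fun c hc hc2 hle => ?_, fun c hc hc2 hle => ?_, fun c hc hc2 hle => ?_,
    fun c hc hc2 hle c' hc' hc2' hle' hlt' => ?_⟩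
  · have h1 := hw.count c
    have h3 := count_insert_erase (N := N) he hf c
    rw [h.col_pe cur hm h2] at h3
    lia
  · exact Finset.mem_insert_of_mem (Finset.mem_erase.2
      ⟨(hpe c hc hc2 hle).symm, hw.mem c hc hc2 (by lia)⟩)
  · rw [Finset.mem_insert, Finset.mem_erase]
    rintro (h1 | h1)
    exacts [hpf c hc hc2 hle h1.symm, hw.notMem c hc hc2 (by lia) h1.2]
  · exact symmExchange_minTree.exchange_exchange hf he (hw.notMem c hc hc2 (by lia))
      (hw.mem c hc hc2 (by lia)) (hpf c hc hc2 hle) (hpe c hc hc2 hle) hij (hno c hc hc2 hle)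
      (hw.exchange c hc hc2 (by lia))
  · exact symmExchange_minTree.not_exchange_exchange hw.minTree he
      (hw.notMem c' hc' hc2' (by lia)) (hw.mem c hc hc2 (by lia)) (hpe c hc hc2 hle)
      (hno c' hc' hc2' hle') (hw.triangular c hc hc2 (by lia) c' hc' hc2' (by lia) hlt')

/-- Along the whole path only two counts change. The start `c₀` loses one edge but was overused, so
it stays used up; the end gains one but had room, so it creates no excess. -/
theorem Walk.dual_and_excess_lt {c₀ cur : ℕ} (h : N.Search T ord lam pe pf r)
    (hw : N.Walk T ord lam pe pf c₀ S cur) (hc₀ : c₀ < N.m)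
    (hover : N.up c₀ + 1 < N.count c₀ T) (hcur : ord cur = 1) :
    N.Dual lam S ∧ N.excess S < N.excess T := by
  have hdef := (h.ord_eq_one cur hw.cur_lt).1 hcur
  refine ⟨⟨hw.minTree, h.dual.nonneg, fun c hc h0 => ?_⟩,
    Finset.sum_lt_sum (fun c _ => ?_) ⟨c₀, Finset.mem_range.2 hc₀, ?_⟩⟩
  · have h1 := hw.count c
    have h3 := h.dual.slack c hc h0
    split_ifs at h1 with h4 h5 <;> first | subst h4 | skip
    all_goals lia
  · have h1 := hw.count c
    split_ifs at h1 with h4 h5 h5 <;> first | subst h4 | subst h5 | skip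
    all_goals lia
  · have h1 := hw.count c₀
    rw [if_pos rfl] at h1
    split_ifs at h1 with h5
    · subst h5; lia
    · lia

/-- Every tree edge contributes to one colour only. This bounds the number of augmentations. -/
theorem excess_add_one_le (hT : N.Tree T) : N.excess T + 1 ≤ N.n := by
  rw [← hT.card]
  refine Nat.add_le_add_right ?_ 1
  rw [Finset.card_eq_sum_card_fiberwise (t := Finset.range N.m) (f := N.col)
    fun j hj => Finset.mem_coe.2 (Finset.mem_range.2 (N.col_lt j (hT.lt j hj)))]
  exact Finset.sum_le_sum fun c _ => Nat.sub_le _ _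

theorem excess_eq_zero_iff : N.excess T = 0 ↔ ∀ c < N.m, N.count c T ≤ N.up c + 1 := by
  simp [excess, Finset.sum_eq_zero_iff, Nat.sub_eq_zero_iff_le]

end Net

end GDC

/-! ### Programs with bounded loops -/

namespace RealRAM

/-- Programs whose loops `loopTo v k d p` run `p` with the counter `v` running through the numbers
below `N - d`, where `N` is the cell `k` of the array `0`. -/
inductive Block where
  | skip
  | setNat (a : ℕ) (i x : NatExpr)
  | setReal (a : ℕ) (i : NatExpr) (x : RealExpr)
  | seq (p q : Block)
  | ite (c : Cond) (p q : Block)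
  | loopTo (v k d : ℕ) (p : Block)

/-- The cell `0` of the array `a`, used as a variable. -/
def NatExpr.var (a : ℕ) : NatExpr := .get a (.lit 0)

@[simp]
theorem NatExpr.eval_var (s : Mem) (a : ℕ) : (NatExpr.var a).eval s = s.nat a 0 := rfl

@[simp]
theorem Mem.nat_writeNat (s : Mem) (a i x b : ℕ) :
    (s.writeNat a i x).nat b = if b = a then Function.update (s.nat a) i x else s.nat b := by
  simp [Mem.writeNat, Function.update_apply]

@[simp]
theorem Mem.real_writeNat (s : Mem) (a i x : ℕ) : (s.writeNat a i x).real = s.real := rfl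

@[simp]
theorem Mem.real_writeReal (s : Mem) (a i : ℕ) (x : ℝ) (b : ℕ) :
    (s.writeReal a i x).real b = if b = a then Function.update (s.real a) i x else s.real b := by
  simp [Mem.writeReal, Function.update_apply]

@[simp]
theorem Mem.nat_writeReal (s : Mem) (a i : ℕ) (x : ℝ) : (s.writeReal a i x).nat = s.nat := rfl

namespace Block

/-- The increment of the counter turns the test `≤` into a strict comparison. -/
def counterLt (v k d : ℕ) : Cond :=
  .natLe (.add (.var v) (.lit 1)) (.sub (.get 0 (.lit k)) (.lit d))

def compile : Block → Program
  | skip => .skip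
  | setNat a i x => .setNat a i x
  | setReal a i x => .setReal a i x
  | seq p q => .seq p.compile q.compile
  | ite c p q => .branch c p.compile q.compile
  | loopTo v k d p => .seq (.setNat v (.lit 0) (.lit 0)) (.loop (counterLt v k d)
      (.seq p.compile (.setNat v (.lit 0) (.add (.var v) (.lit 1)))))

open Classical in
/-- The memory after the execution. -/
noncomputable def run : Block → Mem → Mem
  | skip, s => s
  | setNat a i x, s => s.writeNat a (i.eval s) (x.eval s)
  | setReal a i x, s => s.writeReal a (i.eval s) (x.eval s)
  | seq p q, s => q.run (p.run s)
  | ite c p q, s => if c.Holds s then p.run s else q.run s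
  | loopTo v k d p, s =>
      (fun s => (p.run s).writeNat v 0 ((p.run s).nat v 0 + 1))^[s.nat 0 k - d] (s.writeNat v 0 0)

/-- The array `a` of natural numbers is not written. -/
def keepsNat (a : ℕ) : Block → Bool
  | skip => true
  | setNat b _ _ => a != b
  | setReal _ _ _ => true
  | seq p q => p.keepsNat a && q.keepsNat a
  | ite _ p q => p.keepsNat a && q.keepsNat a
  | loopTo v _ _ p => a != v && p.keepsNat a

/-- The array `a` of real numbers is not written. -/
def keepsReal (a : ℕ) : Block → Bool
  | skip => true
  | setNat _ _ _ => true
  | setReal b _ _ => a != b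
  | seq p q => p.keepsReal a && q.keepsReal a
  | ite _ p q => p.keepsReal a && q.keepsReal a
  | loopTo _ _ _ p => p.keepsReal a

/-- No loop writes its own counter. -/
def ok : Block → Bool
  | skip => true
  | setNat _ _ _ => true
  | setReal _ _ _ => true
  | seq p q => p.ok && q.ok
  | ite _ p q => p.ok && q.ok
  | loopTo v _ _ p => p.keepsNat v && p.ok

open Polynomial in
/-- A bound for the running time in terms of a bound for the entries of the array `0`. -/
noncomputable def time : Block → ℕ[X]
  | skip => 1
  | setNat _ i x => C (i.cost + x.cost + 1)
  | setReal _ i x => C (i.cost + x.cost + 1)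
  | seq p q => p.time + q.time
  | ite c p q => C (c.cost + 1) + p.time + q.time
  | loopTo v k d p => X * (p.time + C ((counterLt v k d).cost + 7)) +
      C ((counterLt v k d).cost + 4)

/-- The arrays that `p` does not write agree. -/
def Frame (p : Block) (s s' : Mem) : Prop :=
  (∀ a, p.keepsNat a = true → s'.nat a = s.nat a) ∧
    ∀ a, p.keepsReal a = true → s'.real a = s.real a

/-- With this, that a program leaves an array untouched is a Boolean computation on its syntax, so
such claims are settled by `rfl`. -/
theorem frame_run (p : Block) (s : Mem) : p.Frame s (p.run s) := by
  induction p generalizing s with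
  | skip => exact ⟨fun _ _ => rfl, fun _ _ => rfl⟩
  | setNat b i x =>
    refine ⟨fun a h => ?_, fun _ _ => rfl⟩
    simp only [keepsNat, bne_iff_ne] at h
    simp [run, h]
  | setReal b i x =>
    refine ⟨fun _ _ => rfl, fun a h => ?_⟩
    simp only [keepsReal, bne_iff_ne] at h
    simp [run, h]
  | seq p q ihp ihq =>
    refine ⟨fun a h => ?_, fun a h => ?_⟩
    · simp only [keepsNat, Bool.and_eq_true] at h
      exact ((ihq _).1 a h.2).trans ((ihp s).1 a h.1)
    · simp only [keepsReal, Bool.and_eq_true] at h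
      exact ((ihq _).2 a h.2).trans ((ihp s).2 a h.1)
  | ite c p q ihp ihq =>
    refine ⟨fun a h => ?_, fun a h => ?_⟩
    · simp only [keepsNat, Bool.and_eq_true] at h
      rw [run]
      split_ifs
      exacts [(ihp s).1 a h.1, (ihq s).1 a h.2]
    · simp only [keepsReal, Bool.and_eq_true] at h
      rw [run]
      split_ifs
      exacts [(ihp s).2 a h.1, (ihq s).2 a h.2]
  | loopTo v k d p ih =>
    refine ⟨fun a h => ?_, fun a h => ?_⟩
    · simp only [keepsNat, Bool.and_eq_true, bne_iff_ne] at h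
      rw [run]
      generalize s.nat 0 k - d = N
      induction N with
      | zero => simp [h.1]
      | succ N ihN =>
        rw [Function.iterate_succ_apply']
        exact ((Mem.nat_writeNat ..).trans (if_neg h.1)).trans (((ih _).1 a h.2).trans ihN)
    · simp only [keepsReal] at h
      rw [run]
      generalize s.nat 0 k - d = N
      induction N with
      | zero => rfl
      | succ N ihN =>
        rw [Function.iterate_succ_apply']
        exact ((ih _).2 a h).trans ihN

theorem iterate_counter {v : ℕ} {p : Block} (hv : p.keepsNat v = true) (s : Mem) (i : ℕ) :
    ((fun s => (p.run s).writeNat v 0 ((p.run s).nat v 0 + 1))^[i] (s.writeNat v 0 0)).nat v 0 =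
      i := by
  induction i with
  | zero => simp
  | succ i ih =>
    rw [Function.iterate_succ_apply', Mem.nat_writeNat, if_pos rfl, Function.update_self,
      (frame_run p _).1 v hv, ih]

/-- Induction along a loop. -/
theorem loopTo_induction {v k d : ℕ} {p : Block} {s : Mem} (I : ℕ → Mem → Prop)
    (hv : p.keepsNat v = true) (hw : ∀ i s' j, I i s' → I i (s'.writeNat v 0 j)) (h0 : I 0 s)
    (step : ∀ i s', i < s.nat 0 k - d → s'.nat v 0 = i → (loopTo v k d p).Frame s s' → I i s' →
      I (i + 1) (p.run s')) :
    I (s.nat 0 k - d) ((loopTo v k d p).run s) := by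
  rw [run]
  have key : ∀ i ≤ s.nat 0 k - d, ∀ s', s' =
      (fun s => (p.run s).writeNat v 0 ((p.run s).nat v 0 + 1))^[i] (s.writeNat v 0 0) →
      (loopTo v k d p).Frame s s' ∧ I i s' := by
    intro i hi
    induction i with
    | zero =>
      rintro s' rfl
      refine ⟨⟨fun a h => ?_, fun a _ => rfl⟩, hw _ _ _ h0⟩
      simp only [keepsNat, Bool.and_eq_true, bne_iff_ne] at h
      simp [h.1]
    | succ i ih =>
      rintro s' rfl
      obtain ⟨hf, hI⟩ := ih (by lia) _ rfl
      rw [Function.iterate_succ_apply']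
      refine ⟨⟨fun a h => ?_, fun a h => ?_⟩,
        hw _ _ _ (step i _ (by lia) (iterate_counter hv s i) hf hI)⟩
      · have h' := h
        simp only [keepsNat, Bool.and_eq_true, bne_iff_ne] at h'
        exact ((Mem.nat_writeNat ..).trans (if_neg h'.1)).trans
          (((frame_run p _).1 a h'.2).trans (hf.1 a h))
      · exact ((frame_run p _).2 a h).trans (hf.2 a h)
  exact (key _ le_rfl _ rfl).2

/-- The array `0` holds all loop bounds and is never written, so the bound `N` for its entries
persists and every loop makes at most `N` passes. -/
theorem exists_runs {b : Block} (hok : b.ok = true) (h0 : b.keepsNat 0 = true) {N : ℕ} {s : Mem}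
    (hs : ∀ k, s.nat 0 k ≤ N) : ∃ t ≤ b.time.eval N, Runs b.compile s t (b.run s) := by
  induction b generalizing s with
  | skip => exact ⟨1, by simp [time], .skip s⟩
  | setNat a i x => exact ⟨_, by simp [time], .setNat a i x s⟩
  | setReal a i x => exact ⟨_, by simp [time], .setReal a i x s⟩
  | seq p q ihp ihq =>
    simp only [ok, keepsNat, Bool.and_eq_true] at hok h0
    obtain ⟨t, ht, h⟩ := ihp hok.1 h0.1 hs
    obtain ⟨t', ht', h'⟩ := ihq hok.2 h0.2 (s := p.run s)
      (fun k => by rw [(frame_run p s).1 0 h0.1]; exact hs k)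
    exact ⟨t + t', by rw [time, Polynomial.eval_add]; lia, .seq h h'⟩
  | ite c p q ihp ihq =>
    simp only [ok, keepsNat, Bool.and_eq_true] at hok h0
    rw [run, time, Polynomial.eval_add, Polynomial.eval_add, Polynomial.eval_C]
    split_ifs with hc
    · obtain ⟨t, ht, h⟩ := ihp hok.1 h0.1 hs
      exact ⟨_, by lia, .branchTrue hc h⟩
    · obtain ⟨t, ht, h⟩ := ihq hok.2 h0.2 hs
      exact ⟨_, by lia, .branchFalse hc h⟩
  | loopTo v k d p ih =>
    simp only [ok, keepsNat, Bool.and_eq_true, bne_iff_ne] at hok h0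
    set body : Program := .seq p.compile (.setNat v (.lit 0) (.add (.var v) (.lit 1)))
    -- Here `j` counts the remaining passes. Besides body and test, a pass costs `6` for the
    -- increment of the counter and `1` for the loop; the failing last test accounts for the
    -- additive term.
    have key : ∀ j s, (∀ k, s.nat 0 k ≤ N) → s.nat v 0 + j = s.nat 0 k - d ∨
        (j = 0 ∧ s.nat 0 k - d ≤ s.nat v 0) → ∃ t ≤
        j * (p.time.eval N + ((counterLt v k d).cost + 7)) + ((counterLt v k d).cost + 1),
        Runs (.loop (counterLt v k d) body) s t
          ((fun s => (p.run s).writeNat v 0 ((p.run s).nat v 0 + 1))^[j] s) := by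
      intro j
      induction j with
      | zero =>
        intro s hs hj
        refine ⟨_, by simp, .loopFalse ?_⟩
        simp only [counterLt, Cond.Holds, NatExpr.eval, NatExpr.eval_var]
        lia
      | succ j ihj =>
        intro s hs hj
        obtain ⟨t, ht, h⟩ := ih hok.2 h0.2 hs
        have hf := frame_run p s
        have hset := Runs.setNat v (.lit 0) (.add (.var v) (.lit 1)) (p.run s)
        obtain ⟨t', ht', h'⟩ := ihj ((p.run s).writeNat v 0 ((p.run s).nat v 0 + 1))
          (fun k => by simpa [h0.1, hf.1 0 h0.2] using hs k)
          (by simp [h0.1, hf.1 0 h0.2, hf.1 v hok.1]; lia)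
        rw [Function.iterate_succ_apply]
        refine ⟨_, ?_, .loopTrue ?_ (.seq h hset) h'⟩
        · simp only [NatExpr.cost, NatExpr.var]
          rw [Nat.add_mul]
          lia
        · simp only [counterLt, Cond.Holds, NatExpr.eval, NatExpr.eval_var]
          lia
    obtain ⟨t, ht, h⟩ := key (s.nat 0 k - d) (s.writeNat v 0 0)
      (fun k => by simpa [h0.1] using hs k) (by simp [h0.1])
    refine ⟨_, ?_, .seq (.setNat v (.lit 0) (.lit 0) s) h⟩
    simp only [time, Polynomial.eval_add, Polynomial.eval_mul, Polynomial.eval_X,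
      Polynomial.eval_C, NatExpr.cost]
    have h1 : (s.nat 0 k - d) * (p.time.eval N + ((counterLt v k d).cost + 7)) ≤
        N * (p.time.eval N + ((counterLt v k d).cost + 7)) :=
      Nat.mul_le_mul_right _ ((Nat.sub_le _ _).trans (hs k))
    lia

section

variable {s : Mem}

@[simp] theorem run_skip : skip.run s = s := rfl

@[simp] theorem run_setNat (a : ℕ) (i x : NatExpr) :
    (setNat a i x).run s = s.writeNat a (i.eval s) (x.eval s) := rfl

@[simp] theorem run_setReal (a : ℕ) (i : NatExpr) (x : RealExpr) :
    (setReal a i x).run s = s.writeReal a (i.eval s) (x.eval s) := rfl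

@[simp] theorem run_seq (p q : Block) : (seq p q).run s = q.run (p.run s) := rfl

theorem run_ite_pos {c : Cond} (h : c.Holds s) (p q : Block) : (ite c p q).run s = p.run s :=
  if_pos h

theorem run_ite_neg {c : Cond} (h : ¬ c.Holds s) (p q : Block) : (ite c p q).run s = q.run s :=
  if_neg h

end

end Block

/-- Equality of natural numbers as a test. -/
def Cond.natEq (x y : NatExpr) : Cond := .and (.natLe x y) (.natLe y x)

@[simp]
theorem Cond.holds_natEq {s : Mem} {x y : NatExpr} :
    (Cond.natEq x y).Holds s ↔ x.eval s = y.eval s :=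
  le_antisymm_iff.symm

end RealRAM

/-! ### Components and minimum spanning trees on the machine -/

namespace GDC

open RealRAM

/-- The edges marked by `1` in the array `g`. -/
def Net.marked (N : Net) (g : ℕ → ℕ) : Finset ℕ := (Finset.range N.m).filter fun j => g j = 1

namespace Net

variable {N : Net} {g : ℕ → ℕ} {i j : ℕ}

theorem mem_marked : j ∈ N.marked g ↔ j < N.m ∧ g j = 1 := by
  simp [marked]

theorem marked_update_one (hj : j < N.m) :
    N.marked (Function.update g j 1) = insert j (N.marked g) := by
  ext i
  by_cases h : i = j <;> simp [mem_marked, h, hj]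

theorem marked_update_zero : N.marked (Function.update g j 0) = (N.marked g).erase j := by
  ext i
  by_cases h : i = j <;> simp [mem_marked, h]

/-- The memory holds the data of `N`. -/
structure Loaded (N : Net) (s : Mem) : Prop where
  n : s.nat 0 0 = N.n
  m : s.nat 0 1 = N.m
  x : s.nat 1 = N.x
  y : s.nat 2 = N.y
  up : s.nat 6 = N.up
  col : s.nat 9 = N.col
  w : s.real 0 = N.w

end Net

/-- The arrays with the data of a net are not written. -/
def keepsNet (p : Block) : Bool :=
  p.keepsNat 0 && p.keepsNat 1 && p.keepsNat 2 && p.keepsNat 6 && p.keepsNat 9 && p.keepsReal 0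

theorem Net.Loaded.frame {N : Net} {s s' : Mem} {p : Block} (h : N.Loaded s) (hf : p.Frame s s')
    (hp : keepsNet p = true) : N.Loaded s' := by
  simp only [keepsNet, Bool.and_eq_true] at hp
  obtain ⟨⟨⟨⟨⟨h0, h1⟩, h2⟩, h6⟩, h9⟩, hr⟩ := hp
  exact ⟨hf.1 0 h0 ▸ h.n, hf.1 0 h0 ▸ h.m, hf.1 1 h1 ▸ h.x, hf.1 2 h2 ▸ h.y, hf.1 6 h6 ▸ h.up,
    hf.1 9 h9 ▸ h.col, hf.2 0 hr ▸ h.w⟩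

theorem Net.Loaded.run {N : Net} {s : Mem} {p : Block} (h : N.Loaded s)
    (hp : keepsNet p = true) : N.Loaded (p.run s) :=
  h.frame (p.frame_run s) hp

/-- Replaces the label in the variable `22` by the label in the variable `23`. -/
def relabel : Block :=
  .loopTo 21 0 0 (.ite (.natEq (.get 11 (.var 21)) (.var 22))
    (.setNat 11 (.var 21) (.var 23)) .skip)

/-- Labels the vertices in the array `11` by the components of the marked edges. -/
def components : Block :=
  .seq (.loopTo 21 0 0 (.setNat 11 (.var 21) (.var 21)))
    (.loopTo 20 1 0 (.ite (.natEq (.get 8 (.var 20)) (.lit 1))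
      (.seq (.setNat 22 (.lit 0) (.get 11 (.get 1 (.var 20))))
        (.seq (.setNat 23 (.lit 0) (.get 11 (.get 2 (.var 20)))) relabel)) .skip))

theorem relabel_spec (s : Mem) : ∀ v < s.nat 0 0, (relabel.run s).nat 11 v =
    if s.nat 11 v = s.nat 22 0 then s.nat 23 0 else s.nat 11 v := by
  have h := Block.loopTo_induction (s := s) (v := 21) (k := 0) (d := 0)
    (p := .ite (.natEq (.get 11 (.var 21)) (.var 22)) (.setNat 11 (.var 21) (.var 23)) .skip)
    (fun i s' => ∀ v, s'.nat 11 v =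
      if v < i ∧ s.nat 11 v = s.nat 22 0 then s.nat 23 0 else s.nat 11 v)
    rfl (fun _ _ _ h => h) (by simp) ?_
  · intro v hv
    rw [relabel, h]
    simp [hv]
  · intro i s' hi hc hf hI v
    have h22 := hf.1 22 rfl
    have h23 := hf.1 23 rfl
    by_cases hcond : s.nat 11 i = s.nat 22 0
    · rw [Block.run_ite_pos (by simp [NatExpr.eval, hc, hI, h22, hcond])]
      by_cases hv : v = i
      · subst hv
        simp [h23, hc, hcond]
      · have : v < i + 1 ↔ v < i := by lia
        simp [hc, hI, hv, this]
    · rw [Block.run_ite_neg (by simp [NatExpr.eval, hc, hI, h22, hcond])]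
      by_cases hv : v = i
      · subst hv
        simp [hI, hcond]
      · have : v < i + 1 ↔ v < i := by lia
        simp [hI, this]

theorem filter_range_succ (P : ℕ → Prop) [DecidablePred P] (i : ℕ) :
    (Finset.range (i + 1)).filter P =
      if P i then insert i ((Finset.range i).filter P) else (Finset.range i).filter P := by
  rw [Finset.range_add_one, Finset.filter_insert]

/-- Each vertex starts with its own label. After `i` passes equal labels mean connection by the
marked edges below `i`; merging the two labels of the next marked edge matches `Conn.insert_iff`. -/
theorem components_spec {N : Net} {s : Mem} (h : N.Loaded s) : ∀ u < N.n, ∀ v < N.n,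
    (components.run s).nat 11 u = (components.run s).nat 11 v ↔
      Conn N.x N.y (N.marked (s.nat 8)) u v := by
  have h1 := Block.loopTo_induction (s := s) (v := 21) (k := 0) (d := 0)
    (p := .setNat 11 (.var 21) (.var 21))
    (fun i s' => ∀ v < i, s'.nat 11 v = v)
    rfl (fun _ _ _ h => h) (by simp) (fun i s' hi hc hf hI v hv => by
      by_cases hv' : v = i
      · simp [hc, hv']
      · have := hI v (by lia)
        simpa [hc, Function.update_apply, hv'])
  have hf1 := Block.frame_run (.loopTo 21 0 0 (.setNat 11 (.var 21) (.var 21))) s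
  rw [components, Block.run_seq]
  generalize (Block.loopTo 21 0 0 (.setNat 11 (.var 21) (.var 21))).run s = s₁ at h1 hf1 ⊢
  have hL := h.frame hf1 rfl
  have h8 : s₁.nat 8 = s.nat 8 := hf1.1 8 rfl
  have h2 := Block.loopTo_induction (s := s₁) (v := 20) (k := 1) (d := 0)
    (p := .ite (.natEq (.get 8 (.var 20)) (.lit 1))
      (.seq (.setNat 22 (.lit 0) (.get 11 (.get 1 (.var 20))))
        (.seq (.setNat 23 (.lit 0) (.get 11 (.get 2 (.var 20)))) relabel)) .skip)
    (fun i s' => ∀ u < N.n, ∀ v < N.n, s'.nat 11 u = s'.nat 11 v ↔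
      Conn N.x N.y ((Finset.range i).filter fun j => s.nat 8 j = 1) u v)
    rfl (fun _ _ _ h => h) (fun u hu v hv => by
      rw [h.n] at h1
      rw [h1 u (by lia), h1 v (by lia)]
      simp [Conn.empty_iff]) ?_
  · intro u hu v hv
    rw [h2 u hu v hv, hL.m]
    rfl
  · intro i s' hi hc hf hI u hu v hv
    have hL' := hL.frame hf rfl
    have h8' : s'.nat 8 = s.nat 8 := (hf.1 8 rfl).trans h8
    rw [hL.m] at hi
    rw [filter_range_succ]
    by_cases hm : s.nat 8 i = 1
    · rw [Block.run_ite_pos (by simp [NatExpr.eval, hc, h8', hm]), if_pos hm]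
      have hr := relabel_spec ((s'.writeNat 22 0 (s'.nat 11 (N.x i))).writeNat 23 0
        (s'.nat 11 (N.y i)))
      simp only [Mem.nat_writeNat] at hr
      norm_num at hr
      rw [hL'.n] at hr
      simp only [Block.run_seq, Block.run_setNat, NatExpr.eval, NatExpr.eval_var, hc,
        Mem.nat_writeNat, hL'.x, hL'.y]
      norm_num
      rw [hc, hr u hu, hr v hv, Conn.insert_iff]
      have hx := N.x_lt i (by lia)
      have hy := N.y_lt i (by lia)
      rw [← hI u hu v hv, ← hI u hu _ hx, ← hI _ hy v hv, ← hI u hu _ hy, ← hI _ hx v hv]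
      grind
    · rw [Block.run_ite_neg (by simp [NatExpr.eval, hc, h8', hm]), if_neg hm]
      exact hI u hu v hv

/-- Marks an edge of minimum weight between different components of the marked edges. -/
def addLightest : Block :=
  .seq components (.seq (.setNat 24 (.lit 0) (.get 0 (.lit 1)))
    (.seq (.loopTo 25 1 0 (.ite (.and
        (.not (.natEq (.get 11 (.get 1 (.var 25))) (.get 11 (.get 2 (.var 25)))))
        (.not (.and (.not (.natEq (.var 24) (.get 0 (.lit 1))))
          (.realLe (.get 0 (.var 24)) (.get 0 (.var 25))))))
      (.setNat 24 (.lit 0) (.var 25)) .skip)) (.setNat 8 (.var 24) (.lit 1))))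

theorem addLightest_spec {N : Net} {s : Mem} (h : N.Loaded s) :
    (N.marked ((addLightest.run s).nat 8) = N.marked (s.nat 8) ∧
      ∀ j < N.m, Conn N.x N.y (N.marked (s.nat 8)) (N.x j) (N.y j)) ∨
    ∃ f < N.m, N.marked ((addLightest.run s).nat 8) = insert f (N.marked (s.nat 8)) ∧
      ¬ Conn N.x N.y (N.marked (s.nat 8)) (N.x f) (N.y f) ∧
      ∀ j < N.m, ¬ Conn N.x N.y (N.marked (s.nat 8)) (N.x j) (N.y j) → N.w f ≤ N.w j := by
  have hcomp := components_spec h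
  have hf1 := components.frame_run s
  rw [addLightest, Block.run_seq, Block.run_seq, Block.run_seq]
  generalize components.run s = s₁ at hcomp hf1 ⊢
  have hL := h.frame hf1 rfl
  have h8 : s₁.nat 8 = s.nat 8 := hf1.1 8 rfl
  set K := Conn N.x N.y (N.marked (s.nat 8)) with hK
  set s₂ := (Block.setNat 24 (.lit 0) (.get 0 (.lit 1))).run s₁ with hs₂
  have hf2 := Block.frame_run (.setNat 24 (.lit 0) (.get 0 (.lit 1))) s₁
  rw [← hs₂] at hf2
  have hL2 := hL.frame hf2 rfl
  have h24 : s₂.nat 24 0 = N.m := by simp [hs₂, NatExpr.eval, hL.m]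
  set p : Block := .ite (.and
        (.not (.natEq (.get 11 (.get 1 (.var 25))) (.get 11 (.get 2 (.var 25)))))
        (.not (.and (.not (.natEq (.var 24) (.get 0 (.lit 1))))
          (.realLe (.get 0 (.var 24)) (.get 0 (.var 25))))))
      (.setNat 24 (.lit 0) (.var 25)) .skip with hp
  have h3 := Block.loopTo_induction (s := s₂) (v := 25) (k := 1) (d := 0) (p := p)
    (fun i s' => (s'.nat 24 0 = N.m ∧ ∀ j < i, K (N.x j) (N.y j)) ∨
      (s'.nat 24 0 < N.m ∧ ¬ K (N.x (s'.nat 24 0)) (N.y (s'.nat 24 0)) ∧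
        ∀ j < i, ¬ K (N.x j) (N.y j) → N.w (s'.nat 24 0) ≤ N.w j))
    rfl (fun _ _ _ h => h) (.inl ⟨h24, by simp⟩) ?_
  · have hf3 := Block.frame_run (.loopTo 25 1 0 p) s₂
    generalize (Block.loopTo 25 1 0 p).run s₂ = s₃ at h3 hf3 ⊢
    have h8' : s₃.nat 8 = s.nat 8 := ((hf3.1 8 rfl).trans (hf2.1 8 rfl)).trans h8
    rw [hL2.m] at h3
    simp only [Block.run_setNat, NatExpr.eval_var, NatExpr.eval, Mem.nat_writeNat, if_pos, h8']
    rcases h3 with ⟨h3, h4⟩ | ⟨h3, h4, h5⟩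
    -- The value `m` stands for no edge found. The mark is then written to cell `m`, which `marked`
    -- ignores.
    · refine .inl ⟨?_, h4⟩
      ext j
      simp only [Net.mem_marked, h3, Function.update_apply]
      constructor <;> rintro ⟨hj, h⟩ <;> refine ⟨hj, ?_⟩
      · rwa [if_neg (by lia)] at h
      · rwa [if_neg (by lia)]
    · exact .inr ⟨_, h3, Net.marked_update_one h3, h4, h5⟩
  · intro i s' hi hc hf hI
    have hL' := hL2.frame hf rfl
    have h11 : s'.nat 11 = s₁.nat 11 := (hf.1 11 rfl).trans (hf2.1 11 rfl)
    rw [hL2.m] at hi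
    have hKi := hcomp (N.x i) (N.x_lt i (by lia)) (N.y i) (N.y_lt i (by lia))
    by_cases hcond : ¬ K (N.x i) (N.y i) ∧ (s'.nat 24 0 ≠ N.m → ¬ N.w (s'.nat 24 0) ≤ N.w i)
    · rw [hp, Block.run_ite_pos (by
        simp only [Cond.Holds, Cond.holds_natEq, NatExpr.eval, NatExpr.eval_var, RealExpr.eval,
          hL'.x, hL'.y, hL'.m, hL'.w, h11, hc, hKi]
        tauto)]
      right
      simp only [Block.run_setNat, NatExpr.eval_var, NatExpr.eval, Mem.nat_writeNat, if_pos,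
        Function.update_self, hc]
      refine ⟨by lia, hcond.1, fun j hj hjK => ?_⟩
      rcases Nat.lt_succ_iff_lt_or_eq.1 hj with hj | rfl
      · rcases hI with ⟨h3, h4⟩ | ⟨h3, h4, h5⟩
        · exact absurd (h4 j hj) hjK
        · exact (not_le.1 (hcond.2 h3.ne)).le.trans (h5 j hj hjK)
      · exact le_rfl
    · rw [hp, Block.run_ite_neg (by
        simp only [Cond.Holds, Cond.holds_natEq, NatExpr.eval, NatExpr.eval_var, RealExpr.eval,
          hL'.x, hL'.y, hL'.m, hL'.w, h11, hc, hKi]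
        tauto)]
      rw [Block.run_skip]
      rcases hI with ⟨h3, h4⟩ | ⟨h3, h4, h5⟩
      · refine .inl ⟨h3, fun j hj => ?_⟩
        rcases Nat.lt_succ_iff_lt_or_eq.1 hj with hj | rfl
        · exact h4 j hj
        · tauto
      · refine .inr ⟨h3, h4, fun j hj hjK => ?_⟩
        rcases Nat.lt_succ_iff_lt_or_eq.1 hj with hj | rfl
        · exact h5 j hj hjK
        · by_contra hle
          exact hcond ⟨hjK, fun _ => hle⟩

/-- Marks the edges of a minimum spanning tree, if there is a spanning tree. -/
def greedy : Block := .loopTo 26 0 1 addLightest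

/-- If a spanning tree exists, each of the `n - 1` rounds gains an edge and stays inside some
minimum tree. The unconditional bound on the cardinality serves to recognize a tree later by
connectedness alone. -/
theorem greedy_spec {N : Net} {s : Mem} (h : N.Loaded s) (h8 : N.marked (s.nat 8) = ∅) :
    (N.marked ((greedy.run s).nat 8)).card ≤ N.n - 1 ∧ ((∃ S, N.Tree S) →
      N.MinTree (fun _ => 0) (N.marked ((greedy.run s).nat 8))) := by
  have h1 := Block.loopTo_induction (s := s) (v := 26) (k := 0) (d := 1) (p := addLightest)
    (fun i s' => (N.marked (s'.nat 8)).card ≤ i ∧ ((∃ S, N.Tree S) →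
      (N.marked (s'.nat 8)).card = i ∧ ∃ S, N.MinTree (fun _ => 0) S ∧ N.marked (s'.nat 8) ⊆ S))
    rfl (fun _ _ _ h => h) (by
      rw [h8]
      exact ⟨le_rfl, fun ⟨S, hS⟩ => ⟨rfl, by
        obtain ⟨T, hT⟩ := Net.exists_minTree (fun _ => 0) hS
        exact ⟨T, hT, Finset.empty_subset T⟩⟩⟩) ?_
  · rw [h.n] at h1
    refine ⟨h1.1, fun hS => ?_⟩
    obtain ⟨hc, S, hS, hsub⟩ := h1.2 hS
    have hcard := hS.1.card
    rw [greedy, Finset.eq_of_subset_of_card_le hsub (by lia)]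
    exact hS
  · intro i s' hi hc hf hI
    have hL := h.frame hf rfl
    rw [h.n] at hi
    rcases addLightest_spec hL with ⟨he, hall⟩ | ⟨f, hfm, he, hfc, hmin⟩
    · rw [he]
      refine ⟨hI.1.trans (Nat.le_succ i), fun hS => ?_⟩
      obtain ⟨hcard, -⟩ := hI.2 hS
      obtain ⟨S, hS⟩ := hS
      obtain ⟨j, hj, hjc⟩ := hS.exists_not_conn (T := N.marked (s'.nat 8)) (by lia)
      exact absurd (hall j hj) hjc
    · have hfm' : f ∉ N.marked (s'.nat 8) := fun hmem => hfc (Conn.of_mem hmem)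
      rw [he, Finset.card_insert_of_notMem hfm']
      refine ⟨Nat.succ_le_succ hI.1, fun hS => ?_⟩
      obtain ⟨hcard, S, hS, hsub⟩ := hI.2 hS
      refine ⟨by rw [hcard], hS.exists_insert hsub hfm hfc fun j hj hjc => ?_⟩
      simpa [Net.cost] using hmin j hj hjc

/-- Tests whether the marked edges connect all vertices. -/
def testConnected : Block :=
  .seq components (.seq (.setNat 27 (.lit 0) (.lit 1))
    (.loopTo 25 0 0 (.ite (.natEq (.get 11 (.var 25)) (.get 11 (.lit 0))) .skip
      (.setNat 27 (.lit 0) (.lit 0)))))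

theorem testConnected_spec {N : Net} {s : Mem} (h : N.Loaded s) (hn : 0 < N.n) :
    (testConnected.run s).nat 27 0 = 1 ↔
      ∀ u < N.n, ∀ v < N.n, Conn N.x N.y (N.marked (s.nat 8)) u v := by
  have hcomp := components_spec h
  have hf1 := components.frame_run s
  rw [testConnected, Block.run_seq, Block.run_seq]
  generalize components.run s = s₁ at hcomp hf1 ⊢
  have hL := h.frame hf1 rfl
  have h2 := Block.loopTo_induction (s := (Block.setNat 27 (.lit 0) (.lit 1)).run s₁) (v := 25)
    (k := 0) (d := 0) (p := .ite (.natEq (.get 11 (.var 25)) (.get 11 (.lit 0))) .skip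
      (.setNat 27 (.lit 0) (.lit 0)))
    (fun i s' => s'.nat 27 0 = 1 ↔ ∀ v < i, s₁.nat 11 v = s₁.nat 11 0)
    rfl (fun _ _ _ h => h) (by simp [NatExpr.eval]) ?_
  · refine h2.trans ?_
    simp only [Block.run_setNat, Mem.nat_writeNat, Nat.sub_zero]
    norm_num
    rw [hL.n]
    constructor
    · exact fun h u hu v hv => (hcomp u hu v hv).1 ((h u hu).trans (h v hv).symm)
    · exact fun h v hv => (hcomp v hv 0 hn).2 (h v hv 0 hn)
  · intro i s' hi hc hf hI
    have h11 : s'.nat 11 = s₁.nat 11 := hf.1 11 rfl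
    by_cases hcond : s₁.nat 11 i = s₁.nat 11 0
    · rw [Block.run_ite_pos (by simp [NatExpr.eval, hc, h11, hcond]), Block.run_skip, hI]
      refine ⟨fun h v hv => ?_, fun h v hv => h v (by lia)⟩
      rcases Nat.lt_succ_iff_lt_or_eq.1 hv with hv | rfl
      exacts [h v hv, hcond]
    · rw [Block.run_ite_neg (by simp [NatExpr.eval, hc, h11, hcond])]
      simp only [Block.run_setNat, NatExpr.eval, Mem.nat_writeNat, if_pos, Function.update_self]
      simpa using ⟨i, by lia, hcond⟩

end GDC

/-! ### The augmentation algorithm on the machine -/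

namespace GDC

open RealRAM

namespace Net

variable (N : Net)

/-- The exchange of `e` for `f` leads from an unreached to a reached colour. -/
structure Cand (T : Finset ℕ) (ord : ℕ → ℕ) (e f : ℕ) : Prop where
  arc : N.Arc T e f
  left : ord (N.col e) = 0
  right : 1 ≤ ord (N.col f)

/-- The pair `(be, bf)` satisfies `Q` and minimizes the change `d` of the modified weight, and
subject to this the order of the colour; or `be = m` and no pair satisfies `Q`. -/
def Best (lam : ℕ → ℝ) (ord : ℕ → ℕ) (Q : ℕ → ℕ → Prop) (be bf : ℕ) (d : ℝ) : Prop :=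
  (be = N.m ∧ ∀ e f, ¬ Q e f) ∨
    (be ≠ N.m ∧ Q be bf ∧ d = N.cost lam bf - N.cost lam be ∧ ∀ e f, Q e f →
      d ≤ N.cost lam f - N.cost lam e ∧
        (N.cost lam f - N.cost lam e = d → ord (N.col bf) ≤ ord (N.col f)))

variable {N} {lam : ℕ → ℝ} {ord : ℕ → ℕ} {Q Q' : ℕ → ℕ → Prop} {be bf e f : ℕ} {d : ℝ}

theorem Best.congr (h : N.Best lam ord Q be bf d) (hQ : ∀ e f, Q' e f ↔ Q e f) :
    N.Best lam ord Q' be bf d := by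
  obtain rfl : Q' = Q := by
    ext e f
    exact hQ e f
  exact h

/-- The hypothesis `hb` is the lexicographic test in the form in which the machine evaluates it: a
candidate that is not strictly cheaper must tie and have smaller order. -/
theorem Best.replace (h : N.Best lam ord Q be bf d) (hQ : ∀ a b, Q' a b ↔ Q a b ∨ a = e ∧ b = f)
    (he : e < N.m)
    (hb : be ≠ N.m → d ≤ N.cost lam f - N.cost lam e →
      N.cost lam f - N.cost lam e ≤ d ∧ ord (N.col f) < ord (N.col bf)) :
    N.Best lam ord Q' e f (N.cost lam f - N.cost lam e) := by
  refine .inr ⟨he.ne, (hQ e f).2 (.inr ⟨rfl, rfl⟩), rfl, fun a b hab => ?_⟩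
  rcases (hQ a b).1 hab with hab | ⟨rfl, rfl⟩
  · rcases h with ⟨-, h⟩ | ⟨h1, -, -, h⟩
    · exact absurd hab (h a b)
    · obtain ⟨h2, h3⟩ := h a b hab
      by_cases hd : d ≤ N.cost lam f - N.cost lam e
      · obtain ⟨h4, h5⟩ := hb h1 hd
        exact ⟨h4.trans h2, fun h6 => h5.le.trans (h3 (by linarith))⟩
      · exact ⟨by linarith, fun h6 => by linarith⟩
  · exact ⟨le_rfl, fun _ => le_rfl⟩

theorem Best.keep (h : N.Best lam ord Q be bf d) (hQ : ∀ a b, Q' a b ↔ Q a b ∨ a = e ∧ b = f)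
    (hbe : be ≠ N.m) (hd : d ≤ N.cost lam f - N.cost lam e)
    (hb : N.cost lam f - N.cost lam e ≤ d → ord (N.col bf) ≤ ord (N.col f)) :
    N.Best lam ord Q' be bf d := by
  rcases h with ⟨h, -⟩ | ⟨-, h1, h2, h⟩
  · exact absurd h hbe
  · refine .inr ⟨hbe, (hQ be bf).2 (.inl h1), h2, fun a b hab => ?_⟩
    rcases (hQ a b).1 hab with hab | ⟨rfl, rfl⟩
    exacts [h a b hab, ⟨hd, fun h => hb h.le⟩]

end Net

/-- The change of the modified weight by the exchange of the edge in the variable `29` for the edge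
in the variable `28`. -/
def change : RealExpr :=
  .sub (.add (.get 0 (.var 28)) (.get 1 (.get 9 (.var 28))))
    (.add (.get 0 (.var 29)) (.get 1 (.get 9 (.var 29))))

/-- The first two tests say that the edge in `28` crosses the cut and has a reached colour. The rest
says that there is no best pair yet or that this one is lexicographically better; strict
inequalities are negated tests. -/
def scanCond : Cond :=
  .and (.and (.not (.natEq (.get 11 (.get 1 (.var 28))) (.get 11 (.get 2 (.var 28)))))
      (.natLe (.lit 1) (.get 14 (.get 9 (.var 28)))))
    (.not (.and (.and (.not (.natEq (.var 30) (.get 0 (.lit 1))))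
        (.realLe (.get 2 (.lit 0)) change))
      (.not (.and (.realLe change (.get 2 (.lit 0)))
        (.not (.natLe (.get 14 (.get 9 (.var 31))) (.get 14 (.get 9 (.var 28)))))))))

def scanStep : Block :=
  .ite scanCond (.seq (.setReal 2 (.lit 0) change)
    (.seq (.setNat 30 (.lit 0) (.var 29)) (.setNat 31 (.lit 0) (.var 28)))) .skip

/-- Compares all exchanges of the edge in the variable `29` with the best exchange so far. -/
def scanEdge : Block :=
  .ite (.and (.natEq (.get 8 (.var 29)) (.lit 1)) (.natEq (.get 14 (.get 9 (.var 29))) (.lit 0)))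
    (.seq (.setNat 8 (.var 29) (.lit 0)) (.seq components (.seq (.setNat 8 (.var 29) (.lit 1))
      (.loopTo 28 1 0 scanStep)))) .skip

/-- Determines the best exchange of an edge of an unreached colour for an edge of a reached
colour. -/
def scan : Block :=
  .seq (.setNat 30 (.lit 0) (.get 0 (.lit 1))) (.loopTo 29 1 0 scanEdge)

/-- The edge `e` is unmarked only while the components of `T - e` are labelled. By
`IsTreeSet.exchange_iff`, these labels decide for all `f` at once whether `e` can be exchanged for
`f`. -/
theorem scanEdge_spec {N : Net} {s : Mem} {e : ℕ} {g : ℕ → ℕ} (h : N.Loaded s)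
    (hg : s.nat 8 = g) (hT : N.Tree (N.marked g)) (he : s.nat 29 0 = e) (hem : e < N.m)
    (hb : N.Best (s.real 1) (s.nat 14)
      (fun a b => N.Cand (N.marked g) (s.nat 14) a b ∧ a < e) (s.nat 30 0) (s.nat 31 0)
      (s.real 2 0)) :
    (scanEdge.run s).nat 8 = g ∧ N.Best (s.real 1) (s.nat 14)
      (fun a b => N.Cand (N.marked g) (s.nat 14) a b ∧ a < e + 1) ((scanEdge.run s).nat 30 0)
      ((scanEdge.run s).nat 31 0) ((scanEdge.run s).real 2 0) := by
  set ord := s.nat 14 with hord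
  set lam := s.real 1 with hlam
  set T := N.marked g with hTdef
  by_cases hcond : g e = 1 ∧ ord (N.col e) = 0
  swap
  · rw [scanEdge, Block.run_ite_neg (by
      simpa only [Cond.Holds, Cond.holds_natEq, NatExpr.eval, NatExpr.eval_var, he, hg, h.col])]
    refine ⟨hg, hb.congr fun a b => and_congr_right fun hab => ⟨fun hlt => ?_, by lia⟩⟩
    rcases Nat.lt_succ_iff_lt_or_eq.1 hlt with hlt | rfl
    · exact hlt
    · exact absurd ⟨(Net.mem_marked.1 hab.arc.mem).2, hab.left⟩ hcond
  rw [scanEdge, Block.run_ite_pos (by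
    simpa only [Cond.Holds, Cond.holds_natEq, NatExpr.eval, NatExpr.eval_var, he, hg, h.col]),
    Block.run_seq, Block.run_seq, Block.run_seq]
  have heT : e ∈ T := Net.mem_marked.2 ⟨hem, hcond.1⟩
  set s₁ := (Block.setNat 8 (.var 29) (.lit 0)).run s with hs₁
  have hf1 := Block.frame_run (.setNat 8 (.var 29) (.lit 0)) s
  rw [← hs₁] at hf1
  have hL1 := h.frame hf1 rfl
  have h8 : s₁.nat 8 = Function.update g e 0 := by simp [hs₁, NatExpr.eval, he, hg]
  have hcomp := components_spec hL1
  rw [h8, Net.marked_update_zero] at hcomp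
  have hf2 := components.frame_run s₁
  generalize components.run s₁ = s₂ at hcomp hf2 ⊢
  have hL2 := hL1.frame hf2 rfl
  have h29 : s₂.nat 29 0 = e := by rw [hf2.1 29 rfl, hf1.1 29 rfl, he]
  have h8' : s₂.nat 8 = Function.update g e 0 := (hf2.1 8 rfl).trans h8
  set s₃ := (Block.setNat 8 (.var 29) (.lit 1)).run s₂ with hs₃
  have hf3 := Block.frame_run (.setNat 8 (.var 29) (.lit 1)) s₂
  rw [← hs₃] at hf3
  have hL3 := hL2.frame hf3 rfl
  have h8'' : s₃.nat 8 = g := by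
    simp [hs₃, NatExpr.eval, h29, h8', ← hcond.1]
  have keepNat : ∀ a ≠ 8, components.keepsNat a = true → s₃.nat a = s.nat a := by
    intro a ha hk
    have ha' : (a != 8) = true := by simpa using ha
    rw [hf3.1 a ha', hf2.1 a hk, hf1.1 a ha']
  have keepReal : ∀ a, s₃.real a = s.real a := by
    intro a
    rw [hf3.2 a rfl, hf2.2 a rfl, hf1.2 a rfl]
  have h11 : s₃.nat 11 = s₂.nat 11 := hf3.1 11 rfl
  rw [← h11] at hcomp
  have h4 := Block.loopTo_induction (s := s₃) (v := 28) (k := 1) (d := 0) (p := scanStep)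
    (fun i s' => N.Best lam ord
      (fun a b => N.Cand T ord a b ∧ (a < e ∨ a = e ∧ b < i)) (s'.nat 30 0)
      (s'.nat 31 0) (s'.real 2 0))
    rfl (fun _ _ _ h => h) (by
      rw [keepNat 30 (by simp) rfl, keepNat 31 (by simp) rfl, keepReal 2]
      exact hb.congr fun a b => by simp) ?_
  · have hf4 := Block.frame_run (.loopTo 28 1 0 scanStep) s₃
    refine ⟨(hf4.1 8 rfl).trans h8'', h4.congr fun a b => and_congr_right fun hab => ?_⟩
    have := hab.arc.lt
    rw [hL3.m]
    lia
  · intro i s' hi hc hf hI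
    have hL' := hL3.frame hf rfl
    rw [hL3.m, Nat.sub_zero] at hi
    have e11 : s'.nat 11 = s₃.nat 11 := hf.1 11 rfl
    have e29 : s'.nat 29 0 = e := by rw [hf.1 29 rfl, keepNat 29 (by simp) rfl, he]
    have e14 : s'.nat 14 = ord := (hf.1 14 rfl).trans (keepNat 14 (by simp) rfl)
    have er1 : s'.real 1 = lam := (hf.2 1 rfl).trans (keepReal 1)
    have hchange : change.eval s' = N.cost lam i - N.cost lam e := by
      simp only [change, RealExpr.eval, NatExpr.eval, NatExpr.eval_var, hc, e29, hL'.w, er1,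
        hL'.col]
      rfl
    have hx := N.x_lt i hi
    have hy := N.y_lt i hi
    have hcand : N.Cand T ord e i ↔ s₃.nat 11 (N.x i) ≠ s₃.nat 11 (N.y i) ∧
        1 ≤ ord (N.col i) := by
      rw [ne_eq, hcomp _ hx _ hy]
      constructor
      · exact fun hC => ⟨(hT.exchange_iff heT hi hx hy).1 hC.arc.tree, hC.right⟩
      · exact fun hC => ⟨⟨heT, hi, (hT.exchange_iff heT hi hx hy).2 hC.1⟩, hcond.2, hC.2⟩
    have hscan : scanCond.Holds s' ↔ N.Cand T ord e i ∧
        (s'.nat 30 0 ≠ N.m → s'.real 2 0 ≤ N.cost lam i - N.cost lam e →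
          N.cost lam i - N.cost lam e ≤ s'.real 2 0 ∧
            ord (N.col i) < ord (N.col (s'.nat 31 0))) := by
      rw [hcand]
      simp only [scanCond, Cond.Holds, Cond.holds_natEq, hchange, RealExpr.eval, NatExpr.eval,
        NatExpr.eval_var, hc, hL'.x, hL'.y, hL'.col, hL'.m, e11, e14]
      rw [not_le]
      tauto
    by_cases hcd : scanCond.Holds s'
    · rw [scanStep, Block.run_ite_pos hcd]
      rw [hscan] at hcd
      simp only [Block.run_seq, Block.run_setNat, Block.run_setReal, hchange, NatExpr.eval,
        NatExpr.eval_var, Mem.nat_writeNat, Mem.nat_writeReal, Mem.real_writeNat,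
        Mem.real_writeReal, if_pos, Function.update_self]
      norm_num
      rw [e29, hc]
      refine hI.replace (fun a b => ?_) hem hcd.2
      constructor
      · rintro ⟨hab, h1 | ⟨rfl, h1⟩⟩
        · exact .inl ⟨hab, .inl h1⟩
        · rcases Nat.lt_or_eq_of_le h1 with h1 | rfl
          exacts [.inl ⟨hab, .inr ⟨rfl, h1⟩⟩, .inr ⟨rfl, rfl⟩]
      · rintro (⟨hab, h1⟩ | ⟨rfl, rfl⟩)
        exacts [⟨hab, by lia⟩, ⟨hcd.1, by lia⟩]
    · rw [scanStep, Block.run_ite_neg hcd, Block.run_skip]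
      rw [hscan] at hcd
      by_cases hce : N.Cand T ord e i
      · rw [and_iff_right hce] at hcd
        push Not at hcd
        refine hI.keep (e := e) (f := i) (fun a b => ?_) hcd.1 hcd.2.1 hcd.2.2
        constructor
        · rintro ⟨hab, h1 | ⟨rfl, h1⟩⟩
          · exact .inl ⟨hab, .inl h1⟩
          · rcases Nat.lt_succ_iff_lt_or_eq.1 h1 with h1 | rfl
            exacts [.inl ⟨hab, .inr ⟨rfl, h1⟩⟩, .inr ⟨rfl, rfl⟩]
        · rintro (⟨hab, h1⟩ | ⟨rfl, rfl⟩)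
          exacts [⟨hab, by lia⟩, ⟨hce, by lia⟩]
      · refine hI.congr fun a b => and_congr_right fun hab => ⟨?_, by lia⟩
        rintro (h1 | ⟨rfl, h1⟩)
        · exact .inl h1
        · rcases Nat.lt_succ_iff_lt_or_eq.1 h1 with h1 | rfl
          exacts [.inr ⟨rfl, h1⟩, absurd hab hce]

theorem scan_spec {N : Net} {s : Mem} (h : N.Loaded s) (hT : N.Tree (N.marked (s.nat 8))) :
    (scan.run s).nat 8 = s.nat 8 ∧ N.Best (s.real 1) (s.nat 14)
      (N.Cand (N.marked (s.nat 8)) (s.nat 14)) ((scan.run s).nat 30 0)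
      ((scan.run s).nat 31 0) ((scan.run s).real 2 0) := by
  rw [scan, Block.run_seq]
  set s₁ := (Block.setNat 30 (.lit 0) (.get 0 (.lit 1))).run s with hs₁
  have hf1 := Block.frame_run (.setNat 30 (.lit 0) (.get 0 (.lit 1))) s
  rw [← hs₁] at hf1
  have hL := h.frame hf1 rfl
  have h2 := Block.loopTo_induction (s := s₁) (v := 29) (k := 1) (d := 0) (p := scanEdge)
    (fun i s' => s'.nat 8 = s.nat 8 ∧ N.Best (s.real 1) (s.nat 14)
      (fun a b => N.Cand (N.marked (s.nat 8)) (s.nat 14) a b ∧ a < i) (s'.nat 30 0) (s'.nat 31 0)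
      (s'.real 2 0))
    rfl (fun _ _ _ h => h)
    ⟨hf1.1 8 rfl, .inl ⟨by simp [hs₁, NatExpr.eval, h.m], by simp⟩⟩ ?_
  · refine ⟨h2.1, h2.2.congr fun a b => ⟨fun hab => ⟨hab, ?_⟩, fun hab => hab.1⟩⟩
    rw [hL.m]
    exact hab.arc.lt_left hT
  · intro i s' hi hc hf ⟨hI, hI'⟩
    rw [hL.m] at hi
    have e14 : s'.nat 14 = s.nat 14 := (hf.1 14 rfl).trans (hf1.1 14 rfl)
    have er1 : s'.real 1 = s.real 1 := (hf.2 1 rfl).trans (hf1.2 1 rfl)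
    have := scanEdge_spec (hL.frame hf rfl) hI hT hc (by lia) (by rwa [e14, er1])
    rwa [e14, er1] at this

/-! ### The search for a path of colours. -/

/-- Raises the penalties of the unreached colours and reaches a new colour by the exchange in the
variables `30` and `31`. -/
def reach : Block :=
  .seq (.loopTo 25 1 0 (.ite (.natEq (.get 14 (.var 25)) (.lit 0))
      (.setReal 1 (.var 25) (.add (.get 1 (.var 25)) (.get 2 (.lit 0)))) .skip))
    (.seq (.setNat 14 (.get 9 (.var 30)) (.add (.var 32) (.lit 2)))
      (.seq (.setNat 15 (.get 9 (.var 30)) (.var 30)) (.setNat 16 (.get 9 (.var 30)) (.var 31))))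

/-- The penalties are raised before the new order is written, so the loop still sees the old set of
unreached colours, including that of the leaving edge. -/
theorem reach_spec {N : Net} {s : Mem} (h : N.Loaded s) :
    (reach.run s).nat 14 =
        Function.update (s.nat 14) (N.col (s.nat 30 0)) (s.nat 32 0 + 2) ∧
      (reach.run s).nat 15 = Function.update (s.nat 15) (N.col (s.nat 30 0)) (s.nat 30 0) ∧
      (reach.run s).nat 16 = Function.update (s.nat 16) (N.col (s.nat 30 0)) (s.nat 31 0) ∧
      ∀ c < N.m, (reach.run s).real 1 c =
        if s.nat 14 c = 0 then s.real 1 c + s.real 2 0 else s.real 1 c := by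
  have h1 := Block.loopTo_induction (s := s) (v := 25) (k := 1) (d := 0)
    (p := .ite (.natEq (.get 14 (.var 25)) (.lit 0))
      (.setReal 1 (.var 25) (.add (.get 1 (.var 25)) (.get 2 (.lit 0)))) .skip)
    (fun i s' => ∀ c, s'.real 1 c =
        if c < i ∧ s.nat 14 c = 0 then s.real 1 c + s.real 2 0 else s.real 1 c)
    rfl (fun _ _ _ h => h) (by simp) ?_
  · have hf1 := Block.frame_run (.loopTo 25 1 0 (.ite (.natEq (.get 14 (.var 25)) (.lit 0))
      (.setReal 1 (.var 25) (.add (.get 1 (.var 25)) (.get 2 (.lit 0)))) .skip)) s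
    rw [reach, Block.run_seq]
    generalize Block.run (.loopTo 25 1 0 (.ite (.natEq (.get 14 (.var 25)) (.lit 0))
      (.setReal 1 (.var 25) (.add (.get 1 (.var 25)) (.get 2 (.lit 0)))) .skip)) s = s₁ at h1 hf1 ⊢
    have hL := h.frame hf1 rfl
    have k14 := hf1.1 14 rfl
    have k15 := hf1.1 15 rfl
    have k16 := hf1.1 16 rfl
    have k30 := hf1.1 30 rfl
    have k31 := hf1.1 31 rfl
    have k32 := hf1.1 32 rfl
    rw [h.m] at h1
    refine ⟨?_, ?_, ?_, fun c hc => ?_⟩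
    · simp [NatExpr.eval, hL.col, k14, k30, k32]
    · simp [NatExpr.eval, hL.col, k15, k30]
    · simp [NatExpr.eval, hL.col, k16, k30, k31]
    · simp [h1 c, hc]
  · intro i s' hi hc hf hI c
    have k14 := hf.1 14 rfl
    have k2 := hf.2 2 rfl
    by_cases hcond : s.nat 14 i = 0
    · rw [Block.run_ite_pos (by simp [NatExpr.eval, hc, k14, hcond])]
      by_cases hv : c = i
      · subst hv
        simp [RealExpr.eval, NatExpr.eval, hc, hcond, hI, k2]
      · have : c < i + 1 ↔ c < i := by lia
        simp [hc, hI, hv, this]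
    · rw [Block.run_ite_neg (by simp [NatExpr.eval, hc, k14, hcond])]
      by_cases hv : c = i
      · subst hv
        simp [hI, hcond]
      · have : c < i + 1 ↔ c < i := by lia
        simp [hI, this]

def searchStep : Block :=
  .seq scan (.ite (.natEq (.var 30) (.get 0 (.lit 1))) .skip reach)

def search : Block := .loopTo 32 1 0 searchStep

/-- The loop counter is the parameter of `Search`. A pass without candidates uses `Search.stay`, any
other pass is a `Search.extend`. -/
theorem search_spec {N : Net} {s : Mem} (h : N.Loaded s)
    (hs : N.Search (N.marked (s.nat 8)) (s.nat 14) (s.real 1) (s.nat 15) (s.nat 16) 0) :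
    (search.run s).nat 8 = s.nat 8 ∧
      N.Search (N.marked (s.nat 8)) ((search.run s).nat 14) ((search.run s).real 1)
        ((search.run s).nat 15) ((search.run s).nat 16) N.m := by
  have h1 := Block.loopTo_induction (s := s) (v := 32) (k := 1) (d := 0) (p := searchStep)
    (fun i s' => s'.nat 8 = s.nat 8 ∧ N.Search (N.marked (s.nat 8)) (s'.nat 14) (s'.real 1)
      (s'.nat 15) (s'.nat 16) i)
    rfl (fun _ _ _ h => h) ⟨rfl, hs⟩ ?_
  · rwa [h.m] at h1
  · intro i s' hi hc hf ⟨h8, hI⟩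
    have hL := h.frame hf rfl
    have hscan := scan_spec hL (by rw [h8]; exact hI.dual.minTree.1)
    have hf1 := scan.frame_run s'
    rw [searchStep, Block.run_seq]
    generalize scan.run s' = s₁ at hscan hf1 ⊢
    have hL1 := hL.frame hf1 rfl
    obtain ⟨k8, hbest⟩ := hscan
    have k14 := hf1.1 14 rfl
    have k15 := hf1.1 15 rfl
    have k16 := hf1.1 16 rfl
    have k32 := hf1.1 32 rfl
    have kr1 := hf1.2 1 rfl
    rw [h8] at k8 hbest
    rcases hbest with ⟨hb, hno⟩ | ⟨hb, hcand, hd, hmin⟩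
    · rw [Block.run_ite_pos (by simpa [NatExpr.eval, hL1.m]), Block.run_skip, k14, k15, k16, kr1]
      refine ⟨k8, hI.stay fun e f hef h0 => ?_⟩
      by_contra h1
      exact hno e f ⟨hef, h0, by lia⟩
    · rw [Block.run_ite_neg (by simpa [NatExpr.eval, hL1.m])]
      obtain ⟨r14, r15, r16, rr⟩ := reach_spec hL1
      refine ⟨((reach.frame_run s₁).1 8 rfl).trans k8, ?_⟩
      rw [r14, r15, r16, k14, k15, k16, k32, hc]
      rw [k14, kr1, hd] at rr
      rw [hd] at hmin
      exact hI.extend hcand.arc hcand.left hcand.right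
        (fun e f hef h0 h1 => hmin e f ⟨hef, h0, h1⟩) rr

/-! ### Augmentation rounds and the final answer. -/

/-- Counts the marked edges of each colour in the array `13`. -/
def countColors : Block :=
  .seq (.loopTo 25 1 0 (.setNat 13 (.var 25) (.lit 0)))
    (.loopTo 25 1 0 (.ite (.natEq (.get 8 (.var 25)) (.lit 1))
      (.setNat 13 (.get 9 (.var 25)) (.add (.get 13 (.get 9 (.var 25))) (.lit 1))) .skip))

theorem countColors_spec {N : Net} {s : Mem} (h : N.Loaded s) : ∀ c < N.m,
    (countColors.run s).nat 13 c = N.count c (N.marked (s.nat 8)) := by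
  have h1 := Block.loopTo_induction (s := s) (v := 25) (k := 1) (d := 0)
    (p := .setNat 13 (.var 25) (.lit 0)) (fun i s' => ∀ c < i, s'.nat 13 c = 0)
    rfl (fun _ _ _ h => h) (by simp) (fun i s' hi hc hf hI c hci => by
      by_cases hv : c = i
      · simp [NatExpr.eval, hc, hv]
      · simpa [NatExpr.eval, hc, hv] using hI c (by lia))
  have hf1 := Block.frame_run (.loopTo 25 1 0 (.setNat 13 (.var 25) (.lit 0))) s
  rw [countColors, Block.run_seq]
  generalize Block.run (.loopTo 25 1 0 (.setNat 13 (.var 25) (.lit 0))) s = s₁ at h1 hf1 ⊢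
  have hL := h.frame hf1 rfl
  have k8 := hf1.1 8 rfl
  rw [h.m] at h1
  have h2 := Block.loopTo_induction (s := s₁) (v := 25) (k := 1) (d := 0)
    (p := .ite (.natEq (.get 8 (.var 25)) (.lit 1))
      (.setNat 13 (.get 9 (.var 25)) (.add (.get 13 (.get 9 (.var 25))) (.lit 1))) .skip)
    (fun i s' => ∀ c < N.m, s'.nat 13 c =
      N.count c ((Finset.range i).filter fun j => s.nat 8 j = 1))
    rfl (fun _ _ _ h => h) (fun c hc => by simp [h1 c hc, Net.count]) ?_
  · rwa [hL.m] at h2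
  · intro i s' hi hc hf hI c hcm
    have hL' := hL.frame hf rfl
    have k8' := (hf.1 8 rfl).trans k8
    rw [hL.m] at hi
    have hci := N.col_lt i (by lia)
    rw [filter_range_succ]
    by_cases hcond : s.nat 8 i = 1
    · rw [Block.run_ite_pos (by simp [NatExpr.eval, hc, k8', hcond]), if_pos hcond]
      have hcount : N.count c (insert i ((Finset.range i).filter fun j => s.nat 8 j = 1)) =
          N.count c ((Finset.range i).filter fun j => s.nat 8 j = 1) +
            if N.col i = c then 1 else 0 := by
        rw [Net.count, Finset.filter_insert]
        split_ifs
        · rw [Finset.card_insert_of_notMem (by simp)]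
          rfl
        · rfl
      rw [hcount, ← hI c hcm]
      by_cases hv : c = N.col i
      · subst hv
        simp [NatExpr.eval, hc, hL'.col]
      · simp [NatExpr.eval, hc, hL'.col, hv, Ne.symm hv]
    · rw [Block.run_ite_neg (by simp [NatExpr.eval, hc, k8', hcond]), if_neg hcond]
      exact hI c hcm

/-- Marks the colours that are not used up as reached. -/
def initSearch : Block :=
  .loopTo 25 1 0 (.ite (.natLe (.get 13 (.var 25)) (.get 6 (.var 25)))
    (.setNat 14 (.var 25) (.lit 1)) (.setNat 14 (.var 25) (.lit 0)))

theorem initSearch_spec {N : Net} {s : Mem} (h : N.Loaded s) : ∀ c < N.m,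
    (initSearch.run s).nat 14 c = if s.nat 13 c ≤ N.up c then 1 else 0 := by
  have h1 := Block.loopTo_induction (s := s) (v := 25) (k := 1) (d := 0)
    (p := .ite (.natLe (.get 13 (.var 25)) (.get 6 (.var 25)))
      (.setNat 14 (.var 25) (.lit 1)) (.setNat 14 (.var 25) (.lit 0)))
    (fun i s' => ∀ c < i, s'.nat 14 c = if s.nat 13 c ≤ N.up c then 1 else 0)
    rfl (fun _ _ _ h => h) (by simp) (fun i s' hi hc hf hI c hci => by
      have k13 := hf.1 13 rfl
      have hL := h.frame hf rfl
      by_cases hcond : s.nat 13 i ≤ N.up i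
      · rw [Block.run_ite_pos (by simpa [Cond.Holds, NatExpr.eval, hc, k13, hL.up])]
        by_cases hv : c = i
        · simp [NatExpr.eval, hc, hv, hcond]
        · simpa [NatExpr.eval, hc, hv] using hI c (by lia)
      · rw [Block.run_ite_neg (by simpa [Cond.Holds, NatExpr.eval, hc, k13, hL.up] using hcond)]
        by_cases hv : c = i
        · simp [NatExpr.eval, hc, hv, hcond]
        · simpa [NatExpr.eval, hc, hv] using hI c (by lia))
  rwa [h.m] at h1

/-- Chooses a reached overused colour. -/
def chooseColor : Block :=
  .seq (.setNat 33 (.lit 0) (.get 0 (.lit 1)))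
    (.loopTo 25 1 0 (.ite (.and
      (.natLe (.add (.get 6 (.var 25)) (.lit 2)) (.get 13 (.var 25)))
      (.natLe (.lit 1) (.get 14 (.var 25)))) (.setNat 33 (.lit 0) (.var 25)) .skip))

theorem chooseColor_spec {N : Net} {s : Mem} (h : N.Loaded s) :
    ((chooseColor.run s).nat 33 0 = N.m ∧
      ∀ c < N.m, N.up c + 2 ≤ s.nat 13 c → s.nat 14 c = 0) ∨
    ((chooseColor.run s).nat 33 0 < N.m ∧
      N.up ((chooseColor.run s).nat 33 0) + 2 ≤ s.nat 13 ((chooseColor.run s).nat 33 0) ∧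
      1 ≤ s.nat 14 ((chooseColor.run s).nat 33 0)) := by
  rw [chooseColor, Block.run_seq]
  set s₁ := (Block.setNat 33 (.lit 0) (.get 0 (.lit 1))).run s with hs₁
  have hf1 := Block.frame_run (.setNat 33 (.lit 0) (.get 0 (.lit 1))) s
  rw [← hs₁] at hf1
  have hL := h.frame hf1 rfl
  have h2 := Block.loopTo_induction (s := s₁) (v := 25) (k := 1) (d := 0)
    (p := .ite (.and
      (.natLe (.add (.get 6 (.var 25)) (.lit 2)) (.get 13 (.var 25)))
      (.natLe (.lit 1) (.get 14 (.var 25)))) (.setNat 33 (.lit 0) (.var 25)) .skip)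
    (fun i s' => (s'.nat 33 0 = N.m ∧
      ∀ c < i, N.up c + 2 ≤ s.nat 13 c → s.nat 14 c = 0) ∨
    (s'.nat 33 0 < N.m ∧ N.up (s'.nat 33 0) + 2 ≤ s.nat 13 (s'.nat 33 0) ∧
      1 ≤ s.nat 14 (s'.nat 33 0)))
    rfl (fun _ _ _ h => h) (.inl ⟨by simp [hs₁, NatExpr.eval, h.m], by simp⟩) ?_
  · rwa [hL.m] at h2
  · intro i s' hi hc hf hI
    rw [hL.m] at hi
    have k13 := (hf.1 13 rfl).trans (hf1.1 13 rfl)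
    have k14 := (hf.1 14 rfl).trans (hf1.1 14 rfl)
    have hL' := hL.frame hf rfl
    by_cases hcond : N.up i + 2 ≤ s.nat 13 i ∧ 1 ≤ s.nat 14 i
    · rw [Block.run_ite_pos (by
        simpa only [Cond.Holds, NatExpr.eval, NatExpr.eval_var, hc, k13, k14, hL'.up])]
      simp only [Block.run_setNat, NatExpr.eval, NatExpr.eval_var, hc, Mem.nat_writeNat, if_pos,
        Function.update_self]
      exact .inr ⟨by lia, hcond⟩
    · rw [Block.run_ite_neg (by
        simpa only [Cond.Holds, NatExpr.eval, NatExpr.eval_var, hc, k13, k14, hL'.up])]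
      refine hI.imp (fun hI => ⟨hI.1, fun c hci hle => ?_⟩) id
      rcases Nat.lt_succ_iff_lt_or_eq.1 hci with hci | rfl
      · exact hI.2 c hci hle
      · by_contra h0
        exact hcond ⟨hle, by lia⟩

/-- Performs the exchanges on the path from the colour in the variable `33`. -/
def follow : Block :=
  .loopTo 25 1 0 (.ite (.natLe (.lit 2) (.get 14 (.var 33)))
    (.seq (.setNat 8 (.get 15 (.var 33)) (.lit 0))
      (.seq (.setNat 8 (.get 16 (.var 33)) (.lit 1))
        (.setNat 33 (.lit 0) (.get 9 (.get 16 (.var 33)))))) .skip)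

/-- The order of the current colour is at most `m + 1` at the start and drops with each exchange, so
`m` passes suffice to bring it down to `1`. -/
theorem follow_spec {N : Net} {s : Mem} (h : N.Loaded s) {T : Finset ℕ}
    (hs : N.Search T (s.nat 14) (s.real 1) (s.nat 15) (s.nat 16) N.m)
    (hT : N.marked (s.nat 8) = T) (hm : s.nat 33 0 < N.m) (hpos : 1 ≤ s.nat 14 (s.nat 33 0)) :
    ∃ cur, s.nat 14 cur = 1 ∧ N.Walk T (s.nat 14) (s.real 1) (s.nat 15) (s.nat 16) (s.nat 33 0)
      (N.marked ((follow.run s).nat 8)) cur := by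
  have h1 := Block.loopTo_induction (s := s) (v := 25) (k := 1) (d := 0)
    (p := .ite (.natLe (.lit 2) (.get 14 (.var 33)))
      (.seq (.setNat 8 (.get 15 (.var 33)) (.lit 0))
        (.seq (.setNat 8 (.get 16 (.var 33)) (.lit 1))
          (.setNat 33 (.lit 0) (.get 9 (.get 16 (.var 33)))))) .skip)
    (fun i s' => N.Walk T (s.nat 14) (s.real 1) (s.nat 15) (s.nat 16) (s.nat 33 0)
      (N.marked (s'.nat 8)) (s'.nat 33 0) ∧
      (s.nat 14 (s'.nat 33 0) = 1 ∨ s.nat 14 (s'.nat 33 0) + i ≤ N.m + 1))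
    rfl (fun _ _ _ h => h) ⟨by rw [hT]; exact hs.walk hm hpos, .inr (hs.ord_le _ hm)⟩ ?_
  · rw [h.m] at h1
    refine ⟨_, ?_, h1.1⟩
    have := h1.1.pos
    have := h1.2
    lia
  · intro i s' hi hc hf ⟨hw, hle⟩
    have k14 := hf.1 14 rfl
    have k15 := hf.1 15 rfl
    have k16 := hf.1 16 rfl
    have hL := h.frame hf rfl
    by_cases hcond : 2 ≤ s.nat 14 (s'.nat 33 0)
    · rw [Block.run_ite_pos (by simpa [Cond.Holds, NatExpr.eval, k14])]
      simp only [Block.run_seq, Block.run_setNat, NatExpr.eval, NatExpr.eval_var, Mem.nat_writeNat]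
      norm_num
      rw [k15, k16, hL.col, Net.marked_update_one (hs.arc _ hw.cur_lt hcond).lt,
        Net.marked_update_zero]
      refine ⟨hw.step hs hcond, ?_⟩
      have := hs.lt _ hw.cur_lt hcond
      lia
    · rw [Block.run_ite_neg (by simpa [Cond.Holds, NatExpr.eval, k14] using hcond)]
      refine ⟨hw, .inl ?_⟩
      have := hw.pos
      rw [Block.run_skip]
      lia

/-- A step that decreases the excess of the marked tree, if possible. -/
def improve : Block :=
  .seq countColors (.seq initSearch (.seq search (.seq chooseColor
    (.ite (.natEq (.var 33) (.get 0 (.lit 1))) .skip follow))))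

/-- If an overused colour is reached, following its path lowers the excess. Otherwise the tree is
left as it is, and either nothing is overused or `Search.not_feasible` applies. -/
theorem improve_spec {N : Net} {s : Mem} (h : N.Loaded s)
    (hd : N.Dual (s.real 1) (N.marked (s.nat 8))) :
    N.Dual ((improve.run s).real 1) (N.marked ((improve.run s).nat 8)) ∧
      (N.excess (N.marked ((improve.run s).nat 8)) < N.excess (N.marked (s.nat 8)) ∨
        N.excess (N.marked ((improve.run s).nat 8)) = 0 ∨ ∀ T, ¬ N.Feasible T) := by
  set T := N.marked (s.nat 8) with hT
  have hcount := countColors_spec h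
  have hf1 := countColors.frame_run s
  simp only [improve, Block.run_seq]
  generalize countColors.run s = s₁ at hcount hf1 ⊢
  have hL1 := h.frame hf1 rfl
  have hinit := initSearch_spec hL1
  have hf2 := initSearch.frame_run s₁
  generalize initSearch.run s₁ = s₂ at hinit hf2 ⊢
  have hL2 := hL1.frame hf2 rfl
  have hT2 : N.marked (s₂.nat 8) = T := by rw [hf2.1 8 rfl, hf1.1 8 rfl]
  have hsearch := search_spec hL2 (by
    rw [hT2]
    refine Net.Search.init ?_ fun c hc => ?_
    · rwa [hf2.2 1 rfl, hf1.2 1 rfl]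
    · rw [hinit c hc, hcount c hc])
  have hf3 := search.frame_run s₂
  generalize search.run s₂ = s₃ at hsearch hf3 ⊢
  have hL3 := hL2.frame hf3 rfl
  rw [hT2] at hsearch
  obtain ⟨k8, hsearch⟩ := hsearch
  have hcount3 : ∀ c < N.m, s₃.nat 13 c = N.count c T := fun c hc => by
    rw [hf3.1 13 rfl, hf2.1 13 rfl, hcount c hc]
  have hchoose := chooseColor_spec hL3
  have hf4 := chooseColor.frame_run s₃
  generalize chooseColor.run s₃ = s₄ at hchoose hf4 ⊢
  have hL4 := hL3.frame hf4 rfl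
  have hT4 : N.marked (s₄.nat 8) = T := by rw [hf4.1 8 rfl, k8, hT2]
  rw [← hf4.1 14 rfl, ← hf4.1 15 rfl, ← hf4.1 16 rfl, ← hf4.2 1 rfl] at hsearch
  rw [← hf4.1 14 rfl] at hchoose
  rcases hchoose with ⟨hm, hall⟩ | ⟨hm, hover, hpos⟩
  · rw [Block.run_ite_pos (by simpa [NatExpr.eval, hL4.m]), Block.run_skip, hT4]
    refine ⟨hsearch.dual, .inr ?_⟩
    by_cases hex : N.excess T = 0
    · exact .inl hex
    · right
      rw [Net.excess_eq_zero_iff] at hex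
      push Not at hex
      obtain ⟨c, hc, hlt⟩ := hex
      exact fun T' => hsearch.not_feasible hc hlt (hall c hc (by rw [hcount3 c hc]; exact hlt))
  · rw [Block.run_ite_neg (by simpa [NatExpr.eval, hL4.m] using hm.ne)]
    obtain ⟨cur, hcur, hw⟩ := follow_spec hL4 hsearch hT4 hm hpos
    rw [hcount3 _ hm] at hover
    obtain ⟨h1, h2⟩ := hw.dual_and_excess_lt hsearch hm hover hcur
    rw [(follow.frame_run s₄).2 1 rfl]
    exact ⟨h1, .inl h2⟩

def improveAll : Block := .loopTo 34 0 0 improve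

/-- As long as no other outcome occurs, each round lowers the excess, which starts below `n`; hence
`n` rounds are enough. -/
theorem improveAll_spec {N : Net} {s : Mem} (h : N.Loaded s)
    (hd : N.Dual (s.real 1) (N.marked (s.nat 8))) :
    N.Dual ((improveAll.run s).real 1) (N.marked ((improveAll.run s).nat 8)) ∧
      (N.excess (N.marked ((improveAll.run s).nat 8)) = 0 ∨ ∀ T, ¬ N.Feasible T) := by
  have h1 := Block.loopTo_induction (s := s) (v := 34) (k := 0) (d := 0) (p := improve)
    (fun i s' => N.Dual (s'.real 1) (N.marked (s'.nat 8)) ∧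
      (N.excess (N.marked (s'.nat 8)) + i ≤ N.n ∨ N.excess (N.marked (s'.nat 8)) = 0 ∨
        ∀ T, ¬ N.Feasible T))
    rfl (fun _ _ _ h => h)
    ⟨hd, .inl ((Nat.le_succ _).trans (Net.excess_add_one_le hd.minTree.1))⟩ ?_
  · rw [h.n] at h1
    refine ⟨h1.1, ?_⟩
    rcases h1.2 with h2 | h2 | h2
    exacts [.inl (by rw [improveAll]; lia), .inl h2, .inr h2]
  · intro i s' hi hc hf ⟨hI, hI'⟩
    obtain ⟨h2, h3⟩ := improve_spec (h.frame hf rfl) hI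
    refine ⟨h2, ?_⟩
    rcases h3 with h3 | h3 | h3
    · rcases hI' with h4 | h4 | h4
      exacts [.inl (by lia), .inr (.inl (by lia)), .inr (.inr h4)]
    · exact .inr (.inl h3)
    · exact .inr (.inr h3)

/-- Writes the answer for the marked tree. -/
def verdict : Block :=
  .seq countColors (.seq (.setNat 7 (.lit 0) (.lit 1))
    (.loopTo 25 1 0 (.ite (.natLe (.add (.get 6 (.var 25)) (.lit 2)) (.get 13 (.var 25)))
      (.setNat 7 (.lit 0) (.lit 0)) .skip)))

theorem verdict_spec {N : Net} {s : Mem} (h : N.Loaded s) :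
    ((verdict.run s).nat 7 0 = 1 ∧ N.excess (N.marked (s.nat 8)) = 0) ∨
      ((verdict.run s).nat 7 0 = 0 ∧ N.excess (N.marked (s.nat 8)) ≠ 0) := by
  have hcount := countColors_spec h
  have hf1 := countColors.frame_run s
  simp only [verdict, Block.run_seq]
  generalize countColors.run s = s₁ at hcount hf1 ⊢
  have hL := (h.frame hf1 rfl).run (p := .setNat 7 (.lit 0) (.lit 1)) rfl
  have h2 := Block.loopTo_induction (s := (Block.setNat 7 (.lit 0) (.lit 1)).run s₁) (v := 25)
    (k := 1) (d := 0) (p := .ite (.natLe (.add (.get 6 (.var 25)) (.lit 2)) (.get 13 (.var 25)))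
      (.setNat 7 (.lit 0) (.lit 0)) .skip)
    (fun i s' => (s'.nat 7 0 = 1 ∧ ∀ c < i, s₁.nat 13 c ≤ N.up c + 1) ∨
      (s'.nat 7 0 = 0 ∧ ¬ ∀ c < i, s₁.nat 13 c ≤ N.up c + 1))
    rfl (fun _ _ _ h => h) (.inl ⟨by simp [NatExpr.eval], by simp⟩) ?_
  · rw [hL.m, Nat.sub_zero] at h2
    rw [Net.excess_eq_zero_iff, ne_eq, Net.excess_eq_zero_iff]
    have hiff : (∀ c < N.m, s₁.nat 13 c ≤ N.up c + 1) ↔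
        ∀ c < N.m, N.count c (N.marked (s.nat 8)) ≤ N.up c + 1 :=
      forall₂_congr fun c hc => by rw [hcount c hc]
    rwa [hiff] at h2
  · intro i s' hi hc hf hI
    have hL' := hL.frame hf rfl
    have k13 : s'.nat 13 = s₁.nat 13 := hf.1 13 rfl
    by_cases hcond : N.up i + 2 ≤ s₁.nat 13 i
    · rw [Block.run_ite_pos (by
        simpa only [Cond.Holds, NatExpr.eval, NatExpr.eval_var, hc, k13, hL'.up])]
      refine .inr ⟨by simp [NatExpr.eval], fun hall => ?_⟩
      have := hall i (by lia)
      lia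
    · rw [Block.run_ite_neg (by
        simpa only [Cond.Holds, NatExpr.eval, NatExpr.eval_var, hc, k13, hL'.up]), Block.run_skip]
      refine hI.imp (fun hI => ⟨hI.1, fun c hci => ?_⟩)
        (fun hI => ⟨hI.1, fun hall => hI.2 fun c hci => hall c (by lia)⟩)
      rcases Nat.lt_succ_iff_lt_or_eq.1 hci with hci | rfl
      · exact hI.2 c hci
      · lia

/-- Determines an optimal feasible tree. -/
def solveNet : Block :=
  .seq greedy (.seq testConnected
    (.ite (.and (.natLe (.lit 1) (.get 0 (.lit 0))) (.natEq (.var 27) (.lit 1)))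
      (.seq improveAll verdict) .skip))

/-- Zero penalties make the slackness condition void, so a greedy tree is a valid start. At the end,
zero excess gives optimality through `Dual.weight_le`, and positive excess leaves only
infeasibility. -/
theorem solveNet_spec {N : Net} {s : Mem} (h : N.Loaded s) (h8 : s.nat 8 = fun _ => 0)
    (h7 : s.nat 7 0 = 0) (hr1 : s.real 1 = fun _ => 0) :
    ((solveNet.run s).nat 7 0 = 1 ∧ N.Feasible (N.marked ((solveNet.run s).nat 8)) ∧
      ∀ T, N.Feasible T → ∑ j ∈ N.marked ((solveNet.run s).nat 8), N.w j ≤ ∑ j ∈ T, N.w j) ∨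
    ((solveNet.run s).nat 7 0 = 0 ∧ ∀ T, ¬ N.Feasible T) := by
  obtain ⟨hcard, htree⟩ := greedy_spec h (by
    ext j
    simp [Net.mem_marked, h8])
  have hf1 := greedy.frame_run s
  simp only [solveNet, Block.run_seq]
  generalize greedy.run s = s₁ at hcard htree hf1 ⊢
  have hL1 := h.frame hf1 rfl
  have htest := testConnected_spec hL1
  have hf2 := testConnected.frame_run s₁
  generalize testConnected.run s₁ = s₂ at htest hf2 ⊢
  have hL2 := hL1.frame hf2 rfl
  have k8 := hf2.1 8 rfl
  have k7 : s₂.nat 7 0 = 0 := by rw [hf2.1 7 rfl, hf1.1 7 rfl, h7]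
  have kr1 : s₂.real 1 = fun _ => 0 := by rw [hf2.2 1 rfl, hf1.2 1 rfl, hr1]
  by_cases hcond : 1 ≤ N.n ∧ s₂.nat 27 0 = 1
  · rw [Block.run_ite_pos (by
      simpa only [Cond.Holds, Cond.holds_natEq, NatExpr.eval, NatExpr.eval_var, hL2.n])]
    have hT := Net.tree_of_connected (T := N.marked (s₁.nat 8))
      (fun j hj => (Net.mem_marked.1 hj).1) (by lia) ((htest hcond.1).1 hcond.2)
    have hdual : N.Dual (s₂.real 1) (N.marked (s₂.nat 8)) := by
      rw [kr1, k8]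
      exact ⟨htree ⟨_, hT⟩, fun _ _ => le_rfl, fun _ _ h => absurd rfl h⟩
    obtain ⟨h3, h4⟩ := improveAll_spec hL2 hdual
    have hL3 := hL2.run (p := improveAll) rfl
    rw [Block.run_seq]
    generalize improveAll.run s₂ = s₃ at h3 h4 hL3 ⊢
    rw [verdict.frame_run s₃ |>.1 8 rfl]
    rcases verdict_spec hL3 with ⟨h5, h6⟩ | ⟨h5, h6⟩
    · have hfeas : N.Feasible (N.marked (s₃.nat 8)) :=
        ⟨h3.minTree.1, Net.excess_eq_zero_iff.1 h6⟩
      exact .inl ⟨h5, hfeas, fun T hT => h3.weight_le hfeas hT⟩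
    · exact .inr ⟨h5, h4.resolve_left h6⟩
  · rw [Block.run_ite_neg (by
      simpa only [Cond.Holds, Cond.holds_natEq, NatExpr.eval, NatExpr.eval_var, hL2.n])]
    refine .inr ⟨k7, fun T hT => hcond ?_⟩
    have hn : 0 < N.n := by
      rw [← hT.1.card]
      lia
    exact ⟨hn, (htest hn).2 (htree ⟨T, hT.1⟩).1.conn⟩

end GDC

/-! ### Instances and nets -/

namespace GDC

open RealRAM

variable {V : Type*} {I : Inst V}

namespace Listing

open Classical in
/-- The positions of the edges of `H`. -/
noncomputable def positions (L : Listing I) (H : SimpleGraph V) : Finset (Fin L.m) :=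
  Finset.univ.filter fun j => L.edge j ∈ I.edgesOf H

/-- The numbers of the edges of `H`. -/
noncomputable def codes (L : Listing I) (H : SimpleGraph V) : Finset ℕ :=
  (L.positions H).map Fin.valEmbedding

variable {L : Listing I} {H : SimpleGraph V}

theorem mem_positions {j : Fin L.m} : j ∈ L.positions H ↔ L.edge j ∈ I.edgesOf H := by
  simp [positions]

theorem mem_codes {j : Fin L.m} : (j : ℕ) ∈ L.codes H ↔ L.edge j ∈ I.edgesOf H := by
  rw [codes, ← mem_positions]
  exact Finset.mem_map' Fin.valEmbedding

theorem lt_of_mem_codes {j : ℕ} (h : j ∈ L.codes H) : j < L.m := by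
  obtain ⟨i, -, rfl⟩ := Finset.mem_map.1 h
  exact i.2

theorem edgesOf_eq : I.edgesOf H = L.edge '' (L.positions H : Set (Fin L.m)) := by
  ext e
  obtain ⟨j, rfl⟩ := L.edge.surjective e
  simp [mem_positions]

theorem card_codes (h : H ≤ I.G) : (L.codes H).card = Nat.card H.edgeSet := by
  have : H.edgeSet = (fun j => (L.edge j : Sym2 V)) '' (L.positions H : Set (Fin L.m)) := by
    ext e
    constructor
    · intro he
      obtain ⟨j, hj⟩ := L.edge.surjective ⟨e, SimpleGraph.edgeSet_mono h he⟩
      refine ⟨j, mem_positions.2 ?_, congrArg Subtype.val hj⟩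
      rw [hj]
      exact he
    · rintro ⟨j, hj, rfl⟩
      exact mem_positions.1 hj
  have hinj : Function.Injective fun j => (L.edge j : Sym2 V) :=
    Subtype.val_injective.comp L.edge.injective
  rw [this, Nat.card_coe_set_eq, Set.ncard_image_of_injective _ hinj, Set.ncard_coe_finset, codes,
    Finset.card_map]

/-- The subgraph with the edges whose numbers belong to `T`. -/
def subgraph (L : Listing I) (T : Finset ℕ) : SimpleGraph V :=
  SimpleGraph.fromEdgeSet {e : Sym2 V | ∃ j : Fin L.m, (j : ℕ) ∈ T ∧ e = L.edge j}

theorem edgeSet_subgraph (T : Finset ℕ) :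
    (L.subgraph T).edgeSet = {e : Sym2 V | ∃ j : Fin L.m, (j : ℕ) ∈ T ∧ e = L.edge j} := by
  rw [subgraph, SimpleGraph.edgeSet_fromEdgeSet]
  refine sdiff_eq_left.2 (Set.disjoint_left.2 ?_)
  rintro e ⟨j, -, rfl⟩
  exact I.G.not_isDiag_of_mem_edgeSet (L.edge j).2

theorem subgraph_le (T : Finset ℕ) : L.subgraph T ≤ I.G := by
  rw [← SimpleGraph.edgeSet_subset_edgeSet, edgeSet_subgraph]
  rintro e ⟨j, -, rfl⟩
  exact (L.edge j).2

theorem edge_mem_edgesOf_subgraph {T : Finset ℕ} {j : Fin L.m} :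
    L.edge j ∈ I.edgesOf (L.subgraph T) ↔ (j : ℕ) ∈ T := by
  rw [Inst.edgesOf, Set.mem_ofPred_eq, edgeSet_subgraph]
  constructor
  · rintro ⟨i, hi, h⟩
    rwa [L.edge.injective (Subtype.val_injective h)]
  · exact fun h => ⟨j, h, rfl⟩

theorem codes_subgraph {T : Finset ℕ} (hT : ∀ j ∈ T, j < L.m) : L.codes (L.subgraph T) = T := by
  ext j
  constructor
  · intro h
    have hj := lt_of_mem_codes h
    exact edge_mem_edgesOf_subgraph.1 (mem_codes (j := ⟨j, hj⟩).1 h)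
  · intro h
    exact mem_codes (j := ⟨j, hT j h⟩).2 (edge_mem_edgesOf_subgraph.2 h)

/-- The net `N` belongs to the instance, whose digraph joins the edges of equal colour. -/
structure Represents (L : Listing I) (N : Net) : Prop where
  n : N.n = L.n
  m : N.m = L.m
  x : ∀ j : Fin L.m, N.x j = L.end₁ j
  y : ∀ j : Fin L.m, N.y j = L.end₂ j
  w : ∀ j : Fin L.m, N.w j = I.w (L.edge j)
  up : ∀ j : Fin L.m, N.up (N.col j) = I.up (L.edge j)
  col : ∀ j j' : Fin L.m, N.col j = N.col j' ↔ j = j' ∨ I.D.Adj (L.edge j) (L.edge j')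
  lo : ∀ e, I.lo e = 0
  loopless : ∀ e, ¬ I.D.Adj e e

namespace Represents

variable {N : Net}

theorem conn_of_reachable (hN : L.Represents N) (h : H ≤ I.G) {a b : V} (hab : H.Reachable a b) :
    Conn N.x N.y (L.codes H) (L.vertex.symm a) (L.vertex.symm b) := by
  obtain ⟨p⟩ := hab
  induction p with
  | nil => exact Conn.refl _
  | @cons a b c hadj p ih =>
    refine Conn.trans ?_ ih
    have hmem : s(a, b) ∈ H.edgeSet := hadj
    obtain ⟨j, hj⟩ := L.edge.surjective ⟨s(a, b), SimpleGraph.edgeSet_mono h hmem⟩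
    have hedge := L.edge_eq j
    have hjc : (j : ℕ) ∈ L.codes H := by
      rw [mem_codes, hj]
      exact hmem
    have hc := Conn.of_mem (x := N.x) (y := N.y) hjc
    rw [hN.x, hN.y] at hc
    rw [hj, Sym2.eq_iff] at hedge
    rcases hedge with ⟨rfl, rfl⟩ | ⟨rfl, rfl⟩
    · simpa using hc
    · simpa using hc.symm

theorem reachable_of_conn (hN : L.Represents N) {u v : Fin L.n}
    (huv : Conn N.x N.y (L.codes H) u v) :
    H.Reachable (L.vertex u) (L.vertex v) := by
  -- `Conn` lives on all natural numbers; adding equality makes the relation reflexive beyond the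
  -- vertex numbers too.
  have key := Conn.rec_equiv (r := fun u v => u = v ∨ ∃ (hu : u < L.n) (hv : v < L.n),
    H.Reachable (L.vertex ⟨u, hu⟩) (L.vertex ⟨v, hv⟩)) ⟨fun _ => .inl rfl, ?_, ?_⟩ ?_ huv
  · rcases key with h | ⟨_, _, h⟩
    · rw [Fin.ext h]
    · exact h
  · rintro u v (h | ⟨hu, hv, h⟩)
    exacts [.inl h.symm, .inr ⟨hv, hu, h.symm⟩]
  · rintro u v p (rfl | ⟨hu, hv, h⟩) (rfl | ⟨hv', hp, h'⟩)
    exacts [.inl rfl, .inr ⟨hv', hp, h'⟩, .inr ⟨hu, hv, h⟩, .inr ⟨hu, hp, h.trans h'⟩]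
  · intro j hj
    have hjm := lt_of_mem_codes hj
    have hmem : (L.edge ⟨j, hjm⟩ : Sym2 V) ∈ H.edgeSet := mem_codes (j := ⟨j, hjm⟩).1 hj
    have hx := hN.x ⟨j, hjm⟩
    have hy := hN.y ⟨j, hjm⟩
    rw [L.edge_eq] at hmem
    simp only at hx hy
    rw [hx, hy]
    exact .inr ⟨Fin.is_lt _, Fin.is_lt _, SimpleGraph.Adj.reachable hmem⟩

theorem isTree_iff [Finite V] (hN : L.Represents N) (h : H ≤ I.G) :
    H.IsTree ↔ N.Tree (L.codes H) := by
  have hV : Nat.card V = N.n := by rw [hN.n, ← Nat.card_congr L.vertex, Nat.card_fin]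
  rw [SimpleGraph.isTree_iff_connected_and_card, hV, ← card_codes (L := L) h]
  constructor
  · rintro ⟨hc, hcard⟩
    refine ⟨fun j hj => by rw [hN.m]; exact lt_of_mem_codes hj, hcard, fun u hu v hv => ?_⟩
    rw [hN.n] at hu hv
    simpa using hN.conn_of_reachable h (hc.preconnected (L.vertex ⟨u, hu⟩) (L.vertex ⟨v, hv⟩))
  · intro hT
    have hn : 0 < L.n := by
      rw [← hN.n, ← hT.card]
      lia
    have : Nonempty V := ⟨L.vertex ⟨0, hn⟩⟩
    refine ⟨⟨fun a b => ?_⟩, hT.card⟩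
    obtain ⟨u, rfl⟩ := L.vertex.surjective a
    obtain ⟨v, rfl⟩ := L.vertex.surjective b
    exact hN.reachable_of_conn (hT.conn u (u.2.trans_eq hN.n.symm) v (v.2.trans_eq hN.n.symm))

theorem weight_eq (hN : L.Represents N) : I.weight H = ∑ j ∈ L.codes H, N.w j := by
  rw [Inst.weight, edgesOf_eq (L := L), finsum_mem_image L.edge.injective.injOn,
    finsum_mem_coe_finset, codes, Finset.sum_map]
  exact Finset.sum_congr rfl fun j _ => (hN.w j).symm

/-- The edges of the colour of `j` are `j` and its dependencies, and `j` is not among the latter for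
lack of loops. -/
theorem ncard_dep_add_one (hN : L.Represents N) {j : Fin L.m} (hj : L.edge j ∈ I.edgesOf H) :
    (I.dep (L.edge j) ∩ I.edgesOf H).ncard + 1 = N.count (N.col j) (L.codes H) := by
  classical
  have h1 : I.dep (L.edge j) ∩ I.edgesOf H =
      L.edge '' (((L.positions H).filter fun i : Fin L.m => N.col i = N.col j).erase j :) := by
    ext e
    obtain ⟨i, rfl⟩ := L.edge.surjective e
    have hl := hN.loopless (L.edge j)
    simp only [Set.mem_inter_iff, Set.mem_image, EmbeddingLike.apply_eq_iff_eq, exists_eq_right,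
      Finset.mem_coe, Finset.mem_erase, Finset.mem_filter, mem_positions, hN.col, Inst.dep,
      Set.mem_ofPred_eq]
    constructor
    · rintro ⟨ha, hi⟩
      refine ⟨?_, hi, .inr ha⟩
      rintro rfl
      exact hl ha
    · rintro ⟨hne, hi, ha⟩
      exact ⟨ha.resolve_left hne, hi⟩
  rw [h1, Set.ncard_image_of_injective _ L.edge.injective, Set.ncard_coe_finset,
    Finset.card_erase_add_one (by simp [mem_positions, hj]), Net.count, codes, Finset.filter_map,
    Finset.card_map]
  rfl

theorem satisfies_iff (hN : L.Represents N) :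
    I.Satisfies H ↔ ∀ c < N.m, N.count c (L.codes H) ≤ N.up c + 1 := by
  constructor
  · intro h c _
    by_cases h0 : N.count c (L.codes H) = 0
    · lia
    · obtain ⟨i, hi⟩ := Finset.card_pos.1 (Nat.pos_of_ne_zero h0)
      obtain ⟨hi', rfl⟩ := Finset.mem_filter.1 hi
      have him : i < L.m := lt_of_mem_codes hi'
      have hmem := mem_codes (j := ⟨i, him⟩).1 hi'
      have h1 := (h _ hmem).2
      have h2 := hN.ncard_dep_add_one hmem
      have h3 := hN.up ⟨i, him⟩
      simp only at h2 h3
      lia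
  · intro h e he
    obtain ⟨j, rfl⟩ := L.edge.surjective e
    have h1 := hN.ncard_dep_add_one he
    have h2 := hN.up j
    have h3 := h (N.col j) (N.col_lt j (j.2.trans_eq hN.m.symm))
    rw [hN.lo]
    exact ⟨Nat.zero_le _, by lia⟩

theorem isFeasible_iff [Finite V] (hN : L.Represents N) (h : H ≤ I.G) :
    I.IsFeasible H ↔ N.Feasible (L.codes H) := by
  rw [Inst.IsFeasible, hN.isTree_iff h, hN.satisfies_iff]
  exact and_iff_right h

theorem correctOutput [Finite V] (hN : L.Represents N) {s : Mem}
    (hs : (s.nat 7 0 = 1 ∧ N.Feasible (N.marked (s.nat 8)) ∧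
      ∀ T, N.Feasible T → ∑ j ∈ N.marked (s.nat 8), N.w j ≤ ∑ j ∈ T, N.w j) ∨
      (s.nat 7 0 = 0 ∧ ∀ T, ¬ N.Feasible T)) : L.CorrectOutput s := by
  rcases hs with ⟨h7, hfeas, hmin⟩ | ⟨h7, hno⟩
  · set T := N.marked (s.nat 8) with hT
    have hle := subgraph_le (L := L) T
    have hcodes : L.codes (L.subgraph T) = T :=
      codes_subgraph fun j hj => hN.m ▸ hfeas.1.lt j hj
    refine .inl ⟨h7, L.subgraph T, ⟨?_, fun T' hT' => ?_⟩, fun j => ?_⟩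
    · rwa [hN.isFeasible_iff hle, hcodes]
    · rw [hN.weight_eq, hN.weight_eq, hcodes]
      exact hmin _ ((hN.isFeasible_iff hT'.1).1 hT')
    · rw [edge_mem_edgesOf_subgraph, hT, Net.mem_marked, hN.m]
      simp
  · exact .inr ⟨h7, fun T hT => hno _ ((hN.isFeasible_iff hT.1).1 hT)⟩

end Represents

end Listing

/-! ### Recovering the colours from the arcs. -/

/-- Colours each edge by the least edge that equals it or has an arc to it. -/
def assignColors : Block :=
  .seq (.loopTo 25 1 0 (.setNat 9 (.var 25) (.var 25)))
    (.loopTo 25 2 0 (.ite (.natLe (.get 9 (.get 4 (.var 25))) (.get 3 (.var 25))) .skip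
      (.setNat 9 (.get 4 (.var 25)) (.get 3 (.var 25)))))

/-- A running minimum over the tails of the arcs into `j`, started at `j`. In a complete digraph
this is the least number in the class of `j`. -/
theorem assignColors_spec (s : Mem) (j : ℕ) (hj : j < s.nat 0 1) :
    ((assignColors.run s).nat 9 j = j ∨
      ∃ r < s.nat 0 2, s.nat 4 r = j ∧ (assignColors.run s).nat 9 j = s.nat 3 r) ∧
    (assignColors.run s).nat 9 j ≤ j ∧
    ∀ r < s.nat 0 2, s.nat 4 r = j → (assignColors.run s).nat 9 j ≤ s.nat 3 r := by
  have h1 := Block.loopTo_induction (s := s) (v := 25) (k := 1) (d := 0)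
    (p := .setNat 9 (.var 25) (.var 25)) (fun i s' => ∀ j < i, s'.nat 9 j = j)
    rfl (fun _ _ _ h => h) (by simp) (fun i s' hi hc hf hI c hci => by
      by_cases hv : c = i
      · simp [hc, hv]
      · simpa [hc, hv] using hI c (by lia))
  have hf1 := Block.frame_run (.loopTo 25 1 0 (.setNat 9 (.var 25) (.var 25))) s
  rw [assignColors, Block.run_seq]
  generalize Block.run (.loopTo 25 1 0 (.setNat 9 (.var 25) (.var 25))) s = s₁ at h1 hf1 ⊢
  have k0 := hf1.1 0 rfl
  have h2 := Block.loopTo_induction (s := s₁) (v := 25) (k := 2) (d := 0)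
    (p := .ite (.natLe (.get 9 (.get 4 (.var 25))) (.get 3 (.var 25))) .skip
      (.setNat 9 (.get 4 (.var 25)) (.get 3 (.var 25))))
    (fun i s' => ∀ j < s.nat 0 1,
      (s'.nat 9 j = j ∨ ∃ r < i, s.nat 4 r = j ∧ s'.nat 9 j = s.nat 3 r) ∧ s'.nat 9 j ≤ j ∧
      ∀ r < i, s.nat 4 r = j → s'.nat 9 j ≤ s.nat 3 r)
    rfl (fun _ _ _ h => h) (fun j hj => by simp [h1 j (by lia)]) ?_
  · rw [k0] at h2
    exact h2 j hj
  · intro i s' hi hc hf hI j hj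
    obtain ⟨h3, h4, h5⟩ := hI j hj
    have k3 := (hf.1 3 rfl).trans (hf1.1 3 rfl)
    have k4 := (hf.1 4 rfl).trans (hf1.1 4 rfl)
    by_cases hcond : s'.nat 9 (s.nat 4 i) ≤ s.nat 3 i
    · rw [Block.run_ite_pos (by simpa [Cond.Holds, NatExpr.eval, hc, k3, k4]), Block.run_skip]
      refine ⟨h3.imp_right fun ⟨r, hr, h⟩ => ⟨r, by lia, h⟩, h4, fun r hr hrj => ?_⟩
      rcases Nat.lt_succ_iff_lt_or_eq.1 hr with hr | rfl
      · exact h5 r hr hrj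
      · rwa [hrj] at hcond
    · rw [Block.run_ite_neg (by simpa [Cond.Holds, NatExpr.eval, hc, k3, k4] using hcond)]
      simp only [Block.run_setNat, NatExpr.eval, NatExpr.eval_var, Mem.nat_writeNat, if_pos, hc,
        k3, k4, Function.update_apply]
      by_cases hji : j = s.nat 4 i
      · rw [if_pos hji]
        rw [← hji] at hcond
        refine ⟨.inr ⟨i, by lia, hji.symm, rfl⟩, by lia, fun r hr hrj => ?_⟩
        rcases Nat.lt_succ_iff_lt_or_eq.1 hr with hr | rfl
        · have := h5 r hr hrj
          lia
        · exact le_rfl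
      · rw [if_neg hji]
        refine ⟨h3.imp_right fun ⟨r, hr, h⟩ => ⟨r, by lia, h⟩, h4, fun r hr hrj => ?_⟩
        rcases Nat.lt_succ_iff_lt_or_eq.1 hr with hr | rfl
        · exact h5 r hr hrj
        · exact absurd hrj.symm hji

/-- The program for the whole problem. -/
def solve : Block := .seq assignColors solveNet

theorem array_apply {α : Type*} [Zero α] {k : ℕ} (f : Fin k → α) (i : Fin k) :
    array f i = f i := by
  simp [array]

namespace Listing

variable (L : Listing I)

theorem nat_input_zero_le (k : ℕ) : L.input.nat 0 k ≤ L.size := by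
  change array ![L.n, L.m, L.a] k ≤ L.size
  rw [array, size]
  split_ifs with h
  · interval_cases k <;> simp <;> lia
  · exact Nat.zero_le _

/-- The computed colour of an edge is the least number of an edge of the same class. -/
theorem assignColors_class {r : Fin L.m → Fin L.m → Prop} (hr : Equivalence r)
    (hadj : ∀ i j, I.D.Adj (L.edge i) (L.edge j) ↔ i ≠ j ∧ r i j) (j : Fin L.m) :
    ∃ c : Fin L.m, (assignColors.run L.input).nat 9 j = c ∧ r c j ∧ ∀ i, r i j → c ≤ i := by
  have htail : ∀ i (hi : i < L.a), L.input.nat 3 i = L.tail ⟨i, hi⟩ := fun i hi =>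
    array_apply (fun r => (L.tail r : ℕ)) ⟨i, hi⟩
  have hhead : ∀ i (hi : i < L.a), L.input.nat 4 i = L.head ⟨i, hi⟩ := fun i hi =>
    array_apply (fun r => (L.head r : ℕ)) ⟨i, hi⟩
  have h2 : L.input.nat 0 2 = L.a := rfl
  obtain ⟨h3, h4, h5⟩ := assignColors_spec L.input j j.2
  rw [h2] at h3 h5
  have hle : ∀ i, r i j → (assignColors.run L.input).nat 9 j ≤ i := by
    intro i hi
    by_cases hij : i = j
    · rwa [hij]
    · obtain ⟨a, rfl, ha⟩ : ∃ a, L.tail a = i ∧ L.head a = j := by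
        obtain ⟨a, ha, ha'⟩ := (L.arc_iff _ _).1 ((hadj i j).2 ⟨hij, hi⟩)
        exact ⟨a, L.edge.injective ha, L.edge.injective ha'⟩
      rw [← htail a a.2]
      exact h5 a a.2 (by rw [hhead a a.2, ← ha])
  rcases h3 with h3 | ⟨a, ha, haj, h3⟩
  · exact ⟨j, h3, hr.refl j, fun i hi => by rw [Fin.le_def, ← h3]; exact hle i hi⟩
  · rw [htail a ha] at h3
    refine ⟨L.tail ⟨a, ha⟩, h3, ?_, fun i hi => by rw [Fin.le_def, ← h3]; exact hle i hi⟩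
    rw [hhead a ha] at haj
    rw [← Fin.ext haj]
    exact ((hadj _ _).1 ((L.arc_iff _ _).2 ⟨⟨a, ha⟩, rfl, rfl⟩)).2

/-- The net of an instance, with the computed colours. -/
noncomputable def net {r : Fin L.m → Fin L.m → Prop} (hr : Equivalence r)
    (hadj : ∀ i j, I.D.Adj (L.edge i) (L.edge j) ↔ i ≠ j ∧ r i j) : Net where
  n := L.n
  m := L.m
  x := array fun j => (L.end₁ j : ℕ)
  y := array fun j => (L.end₂ j : ℕ)
  up := array fun j => I.up (L.edge j)
  col := (assignColors.run L.input).nat 9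
  w := array fun j => I.w (L.edge j)
  x_lt j hj := by
    rw [array, dif_pos hj]
    exact Fin.is_lt _
  y_lt j hj := by
    rw [array, dif_pos hj]
    exact Fin.is_lt _
  col_lt j hj := by
    obtain ⟨c, hc, -⟩ := L.assignColors_class hr hadj ⟨j, hj⟩
    simp only at hc
    rw [hc]
    exact c.2

/-- The least number is a canonical representative, so edges get equal colours exactly when they
share a class. As `u` is constant on classes, the bound can be read at the representative. -/
theorem represents_net {r : Fin L.m → Fin L.m → Prop} (hr : Equivalence r)
    (hadj : ∀ i j, I.D.Adj (L.edge i) (L.edge j) ↔ i ≠ j ∧ r i j) (hlo : ∀ e, I.lo e = 0)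
    (hup : ∀ i j, r i j → I.up (L.edge i) = I.up (L.edge j)) : L.Represents (L.net hr hadj) where
  n := rfl
  m := rfl
  x := array_apply fun j => (L.end₁ j : ℕ)
  y := array_apply fun j => (L.end₂ j : ℕ)
  w := array_apply fun j => I.w (L.edge j)
  up j := by
    obtain ⟨c, hc, hcj, -⟩ := L.assignColors_class hr hadj j
    change array (fun j => I.up (L.edge j)) ((assignColors.run L.input).nat 9 j) = _
    rw [hc, array_apply]
    exact hup c j hcj
  col i j := by
    obtain ⟨c, hc, hci, hmin⟩ := L.assignColors_class hr hadj i
    obtain ⟨d, hd, hdj, hmin'⟩ := L.assignColors_class hr hadj j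
    change (assignColors.run L.input).nat 9 i = (assignColors.run L.input).nat 9 j ↔ _
    rw [hc, hd, hadj, Fin.val_inj]
    constructor
    · rintro rfl
      exact or_iff_not_imp_left.2 fun h => ⟨h, hr.trans (hr.symm hci) hdj⟩
    · intro h
      have hij : r i j := by
        rcases h with rfl | h
        exacts [hr.refl i, h.2]
      exact le_antisymm (hmin d (hr.trans hdj (hr.symm hij))) (hmin' c (hr.trans hci hij))
  lo := hlo
  loopless e := by
    obtain ⟨j, rfl⟩ := L.edge.surjective e
    simp [hadj]

theorem correctOutput_solve [Finite V] {r : Fin L.m → Fin L.m → Prop} (hr : Equivalence r)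
    (hadj : ∀ i j, I.D.Adj (L.edge i) (L.edge j) ↔ i ≠ j ∧ r i j) (hlo : ∀ e, I.lo e = 0)
    (hup : ∀ i j, r i j → I.up (L.edge i) = I.up (L.edge j)) :
    L.CorrectOutput (solve.run L.input) := by
  have hf := assignColors.frame_run L.input
  refine (L.represents_net hr hadj hlo hup).correctOutput (solveNet_spec ?_ ?_ ?_ ?_)
  · exact ⟨congrFun (hf.1 0 rfl) 0, congrFun (hf.1 0 rfl) 1, hf.1 1 rfl, hf.1 2 rfl, hf.1 6 rfl,
      rfl, hf.2 0 rfl⟩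
  · exact hf.1 8 rfl
  · exact congrFun (hf.1 7 rfl) 0
  · exact hf.2 1 rfl

end Listing

end GDC

/-- The generalized dependency constrained minimum spanning tree problem `(G, D, 0, u, w)` is
solvable in polynomial time, by one program for all instances, when `D` is a disjoint union of
complete digraphs with vertex sets `C i` and `u = b i - 1` on `C i`, with `1 ≤ b i ≤ |C i|`. -/
theorem mainTheorem8 :
    ∃ (P : RealRAM.Program) (p : Polynomial ℕ),
      ∀ (V : Type*) [Finite V] (G : SimpleGraph V) (D : Digraph G.edgeSet)
        (u : G.edgeSet → ℕ) (w : G.edgeSet → ℝ)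
        (k : ℕ) (C : Fin k → Set G.edgeSet) (b : Fin k → ℕ),
        GDC.IsDisjointUnionOfComplete D C →
        (∀ i, 1 ≤ b i ∧ b i ≤ (C i).ncard) →
        (∀ i, ∀ e ∈ C i, u e = b i - 1) →
        GDC.SolvesWithin P p
          { G := G, D := D, lo := fun _ => 0, up := u, w := w } := by
  refine ⟨GDC.solve.compile, GDC.solve.time, ?_⟩
  intro V _ G D u w k C b hD _ hu L
  obtain ⟨t, ht, hrun⟩ := RealRAM.Block.exists_runs (b := GDC.solve) rfl rfl L.nat_input_zero_le
  refine ⟨t, _, hrun, ht, ?_⟩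
  have hcover : ∀ e, ∃ i, e ∈ C i := fun e => by
    have : e ∈ ⋃ i, C i := hD.cover ▸ Set.mem_univ e
    simpa using this
  have huniq : ∀ {e i j}, e ∈ C i → e ∈ C j → i = j := fun {e i j} hi hj => by
    by_contra hij
    exact Set.disjoint_left.1 (hD.disjoint i j hij) hi hj
  -- Lying in a common `C i` is reflexive because the classes cover all edges, and transitive
  -- because they are disjoint.
  refine L.correctOutput_solve (r := fun j j' => ∃ i, L.edge j ∈ C i ∧ L.edge j' ∈ C i)
    ⟨fun j => ?_, fun ⟨i, h, h'⟩ => ⟨i, h', h⟩, fun ⟨i, h, h'⟩ ⟨i', k, k'⟩ => ?_⟩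
    (fun j j' => ?_) (fun _ => rfl) fun j j' ⟨i, h, h'⟩ => ?_
  · obtain ⟨i, hi⟩ := hcover (L.edge j)
    exact ⟨i, hi, hi⟩
  · obtain rfl := huniq h' k
    exact ⟨i, h, k'⟩
  · rw [hD.adj_iff]
    simp
  · exact (hu i _ h).trans (hu i _ h').symm
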